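/- Let $R>0$, $\mathrm{Rect}(R,1)=[-R,R]\times[-1,1]$ and, for $\bm x=(x_1,x_2)\in\mathrm{Rect}(R,1)$, $\delta(\bm x)=\min\{x_1+R,\,R-x_1,\,x_2+1,\,1-x_2\}$. Let $S(R,1)=\{(\bm x,\bm y)\in\mathbb R^2\times\mathbb R^2 : \bm x\in \mathrm{Rect}(R,1),\ \|\bm y\|_\infty=\delta(\bm x)\}$, a piecewise linear model of $S^3$. For $\bm a_1=(a_1,b)$, $\bm a_2=(a_2,b)$ with $a_1\le a_2$, $0\le b<1$ and $|a_1|,|a_2|\le R-(1-b)$, define $F:\partial\,\mathrm{Rect}(1,1)\to S(R,1)$ by $F(\bm v)=\bigl((\tfrac{a_2-a_1}{2}\,s(\bm v)+\tfrac{a_1+a_2}{2},\,b),\,(1-b)\bm v\bigr)$, where for $\bm v=(v_1,v_2)$ one puts $s(\bm v)=v_1,\,-v_2,\,-v_1,\,v_2$ on the edges $v_2=-1$, $v_1=1$, $v_2=1$, $v_1=-1$ respectively; let $\mathrm{FS}(\bm a_1,\bm a_2)$ be the image of $F$, a piecewise linear embedded circle. Let $\bm a_i=(a_i,b)$ and $\bm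 a_i'=(a_i',b')$ ($i=1,2$) be two pairs of points satisfying these conditions for the same $R$, and assume $b\ne b'$. Then $\mathrm{FS}(\bm a_1,\bm a_2)\cap \mathrm{FS}(\bm a_1',\bm a_2')=\emptyset$. Furthermore, $\mathrm{FS}(\bm a_1,\bm a_2)$ and $\mathrm{FS}(\bm a_1',\bm a_2')$ are not linked: there is a (tame) embedded 2-sphere in $S(R,1)$ whose complement has exactly two components, one containing $\mathrm{FS}(\bm a_1,\bm a_2)$ and the other containing $\mathrm{FS}(\bm a_1',\bm a_2')$. In particular, for any choice of orientations of the two circles, their linking number is $\mathrm{Lk}(\mathrm{FS}(\bm a_1,\bm a_2),\mathrm{FS}(\bm a_1',\bm a_2'))=0$. -/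

import Mathlib

open Set

noncomputable section

namespace FSLink

/-! ### The piecewise linear model of the 3-sphere -/

/-- The pairs `(x, y)` with `x ∈ ℝ²` and `y ∈ T_x ℝ² = ℝ²`. The norm of Mathlib on `ℝ × ℝ` is the
maximum norm. -/
abbrev TPlane : Type := (ℝ × ℝ) × (ℝ × ℝ)

/-- The rectangle `[-R, R] × [-1, 1]`. -/
def Rect (R : ℝ) : Set (ℝ × ℝ) := Icc (-R) R ×ˢ Icc (-1) 1

/-- The distance, in the maximum norm, from a point of the rectangle to the boundary. -/
def delta (R : ℝ) (x : ℝ × ℝ) : ℝ :=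
  min (min (x.1 + R) (R - x.1)) (min (x.2 + 1) (1 - x.2))

/-- The piecewise linear 3-sphere `S(R, 1)`. -/
def PLSphere (R : ℝ) : Set TPlane := {z | z.1 ∈ Rect R ∧ ‖z.2‖ = delta R z.1}

/-- The boundary of the square `[-1, 1] × [-1, 1]`. -/
def SquareBdry : Set (ℝ × ℝ) := frontier (Rect 1)

/-! ### The circles `FS` -/

/-- The formula of the map `F`, edge by edge: `v₂ = -1`, `v₁ = 1`, `v₂ = 1`, `v₁ = -1`
(the formulas agree at the four corners). -/
def fsFun (a₁ a₂ b : ℝ) (v : ℝ × ℝ) : TPlane :=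
  if v.2 = -1 then (((a₂ - a₁) / 2 * v.1 + (a₁ + a₂) / 2, b), (1 - b) • v)
  else if v.1 = 1 then (((a₁ - a₂) / 2 * v.2 + (a₁ + a₂) / 2, b), (1 - b) • v)
  else if v.2 = 1 then (((a₁ - a₂) / 2 * v.1 + (a₁ + a₂) / 2, b), (1 - b) • v)
  else (((a₂ - a₁) / 2 * v.2 + (a₁ + a₂) / 2, b), (1 - b) • v)

/-- The assumptions on two points `(a₁, b)`, `(a₂, b)` of equal height. The last two say that
`|a₁|` and `|a₂|` are so small compared with `R` that `F` takes its values in `S(R, 1)`. -/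
structure Admissible (R a₁ a₂ b : ℝ) : Prop where
  le : a₁ ≤ a₂
  nonneg : 0 ≤ b
  lt_one : b < 1
  abs_left : |a₁| ≤ R - (1 - b)
  abs_right : |a₂| ≤ R - (1 - b)

theorem mem_squareBdry {v : ℝ × ℝ} : v ∈ SquareBdry ↔ ‖v‖ = 1 := by
  have h : Rect 1 = Metric.closedBall (0 : ℝ × ℝ) 1 := by
    rw [← Prod.mk_zero_zero, ← closedBall_prod_same, Real.closedBall_eq_Icc]
    simp [Rect]
  rw [SquareBdry, h, frontier_closedBall _ one_ne_zero]
  simp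

theorem squareBdry_cases {v : ℝ × ℝ} (hv : v ∈ SquareBdry) :
    (v.1 ∈ Icc (-1 : ℝ) 1 ∧ v.2 ∈ Icc (-1 : ℝ) 1) ∧ (v.2 = -1 ∨ v.1 = 1 ∨ v.2 = 1 ∨ v.1 = -1) := by
  rw [mem_squareBdry, Prod.norm_def, Real.norm_eq_abs, Real.norm_eq_abs] at hv
  have h1 : |v.1| ≤ 1 := hv ▸ le_max_left _ _
  have h2 : |v.2| ≤ 1 := hv ▸ le_max_right _ _
  refine ⟨⟨abs_le.1 h1, abs_le.1 h2⟩, ?_⟩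
  rcases max_choice |v.1| |v.2| with h | h <;> rw [h] at hv <;>
    rcases (abs_eq zero_le_one).1 hv with h' | h' <;> simp [h']

theorem fsFun_snd (a₁ a₂ b : ℝ) (v : ℝ × ℝ) : (fsFun a₁ a₂ b v).2 = (1 - b) • v := by
  unfold fsFun; split_ifs <;> rfl

theorem fsFun_mem {R a₁ a₂ b : ℝ} (h : Admissible R a₁ a₂ b) {v : ℝ × ℝ} (hv : v ∈ SquareBdry) :
    fsFun a₁ a₂ b v ∈ PLSphere R := by
  obtain ⟨⟨⟨h1, h2⟩, h3, h4⟩, -⟩ := squareBdry_cases hv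
  obtain ⟨hle, hb0, hb1, hl, hr⟩ := h
  rw [abs_le] at hl hr
  have key : ∃ s ∈ Icc a₁ a₂, (fsFun a₁ a₂ b v).1 = (s, b) := by
    unfold fsFun
    split_ifs <;> refine ⟨_, ⟨?_, ?_⟩, rfl⟩ <;> nlinarith
  obtain ⟨s, ⟨hs1, hs2⟩, hs⟩ := key
  refine ⟨?_, ?_⟩
  · rw [hs]
    refine ⟨⟨?_, ?_⟩, ?_, ?_⟩ <;> simp only <;> linarith
  · rw [fsFun_snd, norm_smul, mem_squareBdry.1 hv, hs, mul_one, Real.norm_eq_abs,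
      abs_of_pos (by linarith), delta, min_eq_right (a := b + 1) (by linarith), min_eq_right]
    exact le_min (by simp only; linarith) (by simp only; linarith)

/-- The map `F : ∂Rect(1, 1) → S(R, 1)`. -/
def fsMap {R a₁ a₂ b : ℝ} (h : Admissible R a₁ a₂ b) (v : SquareBdry) : PLSphere R :=
  ⟨fsFun a₁ a₂ b v, fsFun_mem h v.2⟩

/-- The circle `FS((a₁, b), (a₂, b))`, as a subset of `S(R, 1)`. -/
def FS {R a₁ a₂ b : ℝ} (h : Admissible R a₁ a₂ b) : Set (PLSphere R) := range (fsMap h)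

/-! ### Unlinked pairs -/

/-- A (tame) embedded 2-sphere in the 3-sphere: some homeomorphism with the round 3-sphere
takes it to the equator. -/
def IsEmbeddedSphere {R : ℝ} (S : Set (PLSphere R)) : Prop :=
  ∃ h : PLSphere R ≃ₜ Metric.sphere (0 : EuclideanSpace ℝ (Fin 4)) 1,
    h '' S = {u | u.1 0 = 0}

/-- `K` and `K'` lie in different components of the complement of `S`, which are two in number. -/
def Separates {R : ℝ} (S K K' : Set (PLSphere R)) : Prop :=
  ∃ A B : Set (PLSphere R), IsOpen A ∧ IsOpen B ∧ IsConnected A ∧ IsConnected B ∧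
    Disjoint A B ∧ A ∪ B = Sᶜ ∧ K ⊆ A ∧ K' ⊆ B

/-- `K` and `K'` are not linked: an embedded 2-sphere separates them. -/
def Unlinked {R : ℝ} (K K' : Set (PLSphere R)) : Prop :=
  ∃ S : Set (PLSphere R), IsEmbeddedSphere S ∧ Separates S K K'

/-! ### Oriented circles and the linking number -/

/-- An oriented parametrized embedded circle in `S(R, 1)`. -/
structure Knot (R : ℝ) where
  base : PLSphere R
  path : Path base base
  inj : InjOn path {t | t ≠ 1}

namespace Knot

variable {R : ℝ}

/-- The underlying set. -/
def image (γ : Knot R) : Set (PLSphere R) := range γ.path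

/-- The same circle with the opposite orientation. -/
def reverse (γ : Knot R) : Knot R where
  base := γ.base
  path := γ.path.symm
  inj := by
    intro s hs t ht hst
    simp only [Path.symm_apply, Function.comp_apply] at hst
    by_cases h : s = 0
    · by_cases h' : t = 0
      · rw [h, h']
      · exfalso
        subst h
        have h1 : γ.path (unitInterval.symm t) = γ.path 0 := by rw [← hst]; simp
        have h2 := γ.inj (show unitInterval.symm t ≠ 1 from fun h => h' (by simpa using h))
          (show (0 : unitInterval) ≠ 1 from zero_ne_one) h1
        exact ht (by simpa using h2)
    · by_cases h' : t = 0
      · exfalso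
        subst h'
        have h1 : γ.path (unitInterval.symm s) = γ.path 0 := by rw [hst]; simp
        have h2 := γ.inj (show unitInterval.symm s ≠ 1 from fun h'' => h (by simpa using h''))
          (show (0 : unitInterval) ≠ 1 from zero_ne_one) h1
        exact hs (by simpa using h2)
      · have := γ.inj (show unitInterval.symm s ≠ 1 from fun h'' => h (by simpa using h''))
          (show unitInterval.symm t ≠ 1 from fun h'' => h' (by simpa using h'')) hst
        simpa using this

/-- The complement of the circle in `S(R, 1)`. -/
abbrev Compl (γ : Knot R) : Type := {z : PLSphere R // z ∉ γ.image}

/-- The first integral homology group of the complement, as the abelianization of the fundamental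
group (written multiplicatively). -/
abbrev H1Compl (γ : Knot R) (q : γ.Compl) : Type := Abelianization (FundamentalGroup γ.Compl q)

/-- The homology class of a loop. -/
def homologyClass (γ : Knot R) {q : γ.Compl} (α : Path q q) : γ.H1Compl q :=
  Abelianization.of (FundamentalGroup.fromPath (Path.Homotopic.Quotient.mk α))

/-- The determinant of four vectors in the coordinates `(x₁, x₂, y₁, y₂)`. -/
def det4 (p q r s : TPlane) : ℝ :=
  Matrix.det !![p.1.1, p.1.2, p.2.1, p.2.2;
                q.1.1, q.1.2, q.2.1, q.2.2;
                r.1.1, r.1.2, r.2.1, r.2.2;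
                s.1.1, s.1.2, s.2.1, s.2.2]

/-- `μ` is an oriented meridian of `γ`: it runs once around the boundary of a disc in `S(R, 1)`
that meets `γ` in a single interior point, transversally and positively. Every ray from the origin
meets `S(R, 1)` exactly once, and the disc is given as the radial projection of the flat disc with
centre `p = γ(t₀)` spanned by `U`, `V`. With `τ` the velocity of `γ` at `p`, the sign condition says
that `(τ, U, V)` is a positive frame of `S(R, 1)`, oriented as a boundary with the outward direction
`p` first. -/
def IsMeridian (γ : Knot R) {m : γ.Compl} (μ : Path m m) : Prop :=
  ∃ t₀ ∈ Ioo (0 : ℝ) 1, ∃ p τ U V : TPlane,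
    (γ.path.extend t₀ : TPlane) = p ∧
    HasDerivAt (fun t : ℝ => (γ.path.extend t : TPlane)) τ t₀ ∧
    0 < det4 p τ U V ∧
    (∀ s s' : ℝ, s ^ 2 + s' ^ 2 ≤ 1 → ∀ c : ℝ, 0 < c → ∀ z ∈ γ.image,
      (z : TPlane) = c • (p + s • U + s' • V) → s = 0 ∧ s' = 0) ∧
    ∀ t : unitInterval, ∃ c : ℝ, 0 < c ∧
      ((μ t).1 : TPlane) =
        c • (p + Real.cos (2 * Real.pi * t) • U + Real.sin (2 * Real.pi * t) • V)

/-- `n` is the linking number of `γ` and `γ'`: the loop `γ'` lies in the complement of `γ` and its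
homology class there is `n` times the class of an oriented meridian `μ` of `γ`. (The path `β` moves
the base point of `μ` to that of `γ'`; its choice does not matter in homology.) -/
def IsLinkingNumber (γ γ' : Knot R) (n : ℤ) : Prop :=
  ∃ (q : γ.Compl) (α : Path q q) (m : γ.Compl) (μ : Path m m) (β : Path q m),
    (∀ t, (α t).1 = γ'.path t) ∧ γ.IsMeridian μ ∧
    γ.homologyClass α = γ.homologyClass ((β.trans μ).trans β.symm) ^ n

end Knot

/-! ### The circles `FS` as oriented circles -/

/-- The truncation of a real number to `[-1, 1]`. -/
def clamp (x : ℝ) : ℝ := max (-1) (min 1 x)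

/-- The counterclockwise parametrization of the boundary of the square, starting at `(-1, -1)`. -/
def squareFun (t : ℝ) : ℝ × ℝ := (clamp (2 - |8 * t - 3|), clamp (2 - |8 * t - 5|))

theorem clamp_mem (x : ℝ) : |clamp x| ≤ 1 := by
  unfold clamp; rw [abs_le]; constructor
  · exact le_max_left _ _
  · exact max_le (by norm_num) (min_le_left _ _)

theorem clamp_of_ge {x : ℝ} (h : 1 ≤ x) : clamp x = 1 := by
  unfold clamp; rw [min_eq_left h]; norm_num

theorem clamp_of_le {x : ℝ} (h : x ≤ -1) : clamp x = -1 := by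
  unfold clamp; rw [min_eq_right (by linarith), max_eq_left h]

theorem clamp_of_mem {x : ℝ} (h : -1 ≤ x) (h' : x ≤ 1) : clamp x = x := by
  unfold clamp; rw [min_eq_right h', max_eq_right h]

theorem squareFun_bottom {t : ℝ} (h : t ∈ Icc 0 (1 / 4 : ℝ)) : squareFun t = (8 * t - 1, -1) := by
  obtain ⟨h0, h1⟩ := h
  rw [squareFun, abs_of_nonpos (by linarith), abs_of_nonpos (by linarith),
    clamp_of_mem (by linarith) (by linarith), clamp_of_le (by linarith)]
  ext <;> simp only; ring

theorem squareFun_right {t : ℝ} (h : t ∈ Icc (1 / 4 : ℝ) (1 / 2)) :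
    squareFun t = (1, 8 * t - 3) := by
  obtain ⟨h0, h1⟩ := h
  rw [squareFun, abs_of_nonpos (a := 8 * t - 5) (by linarith), clamp_of_ge,
    clamp_of_mem (by linarith) (by linarith)]
  · ext <;> simp only; ring
  · have : |8 * t - 3| ≤ 1 := abs_le.2 ⟨by linarith, by linarith⟩
    linarith

theorem squareFun_top {t : ℝ} (h : t ∈ Icc (1 / 2 : ℝ) (3 / 4)) :
    squareFun t = (5 - 8 * t, 1) := by
  obtain ⟨h0, h1⟩ := h
  rw [squareFun, abs_of_nonneg (a := 8 * t - 3) (by linarith), clamp_of_mem (by linarith)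
    (by linarith), clamp_of_ge]
  · ext <;> simp only; ring
  · have : |8 * t - 5| ≤ 1 := abs_le.2 ⟨by linarith, by linarith⟩
    linarith

theorem squareFun_left {t : ℝ} (h : t ∈ Icc (3 / 4 : ℝ) 1) : squareFun t = (-1, 7 - 8 * t) := by
  obtain ⟨h0, h1⟩ := h
  rw [squareFun, abs_of_nonneg (by linarith), abs_of_nonneg (by linarith),
    clamp_of_le (by linarith), clamp_of_mem (by linarith) (by linarith)]
  ext <;> simp only; ring

/-- The four edges of the parametrization. -/
theorem squareFun_cases {t : ℝ} (h : t ∈ Icc (0 : ℝ) 1) :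
    (t ∈ Icc 0 (1 / 4 : ℝ) ∧ squareFun t = (8 * t - 1, -1)) ∨
    (t ∈ Icc (1 / 4 : ℝ) (1 / 2) ∧ squareFun t = (1, 8 * t - 3)) ∨
    (t ∈ Icc (1 / 2 : ℝ) (3 / 4) ∧ squareFun t = (5 - 8 * t, 1)) ∨
    (t ∈ Icc (3 / 4 : ℝ) 1 ∧ squareFun t = (-1, 7 - 8 * t)) := by
  obtain ⟨h0, h1⟩ := h
  rcases le_total t (1 / 4) with h | h
  · exact Or.inl ⟨⟨h0, h⟩, squareFun_bottom ⟨h0, h⟩⟩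
  rcases le_total t (1 / 2) with h2 | h2
  · exact Or.inr (Or.inl ⟨⟨h, h2⟩, squareFun_right ⟨h, h2⟩⟩)
  rcases le_total t (3 / 4) with h3 | h3
  · exact Or.inr (Or.inr (Or.inl ⟨⟨h2, h3⟩, squareFun_top ⟨h2, h3⟩⟩))
  · exact Or.inr (Or.inr (Or.inr ⟨⟨h3, h1⟩, squareFun_left ⟨h3, h1⟩⟩))

theorem squareFun_mem {t : ℝ} (h : t ∈ Icc (0 : ℝ) 1) : squareFun t ∈ SquareBdry := by
  rw [mem_squareBdry, Prod.norm_def]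
  apply le_antisymm
  · exact max_le (clamp_mem _) (clamp_mem _)
  · rcases squareFun_cases h with h | h | h | h <;> rw [h.2] <;> simp

theorem continuous_squareFun : Continuous squareFun := by
  unfold squareFun clamp; fun_prop

theorem squareFun_injOn {s t : ℝ} (hs : s ∈ Ico (0 : ℝ) 1) (ht : t ∈ Ico (0 : ℝ) 1)
    (h : squareFun s = squareFun t) : s = t := by
  have hs1 := hs.2
  have ht1 := ht.2
  rcases squareFun_cases (Ico_subset_Icc_self hs) with ⟨⟨p, q⟩, r⟩ | ⟨⟨p, q⟩, r⟩ | ⟨⟨p, q⟩, r⟩ |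
      ⟨⟨p, q⟩, r⟩ <;>
    rcases squareFun_cases (Ico_subset_Icc_self ht) with ⟨⟨p', q'⟩, r'⟩ | ⟨⟨p', q'⟩, r'⟩ |
      ⟨⟨p', q'⟩, r'⟩ | ⟨⟨p', q'⟩, r'⟩ <;>
    (rw [r, r', Prod.mk.injEq] at h; obtain ⟨e, e'⟩ := h; linarith)

theorem squareFun_surj {v : ℝ × ℝ} (hv : v ∈ SquareBdry) : ∃ t ∈ Icc (0 : ℝ) 1, squareFun t = v := by
  obtain ⟨⟨⟨h1, h2⟩, h3, h4⟩, h | h | h | h⟩ := squareBdry_cases hv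
  · refine ⟨(v.1 + 1) / 8, ⟨by linarith, by linarith⟩, ?_⟩
    rw [squareFun_bottom ⟨by linarith, by linarith⟩]
    ext <;> simp only <;> linarith
  · refine ⟨(v.2 + 3) / 8, ⟨by linarith, by linarith⟩, ?_⟩
    rw [squareFun_right ⟨by linarith, by linarith⟩]
    ext <;> simp only <;> linarith
  · refine ⟨(5 - v.1) / 8, ⟨by linarith, by linarith⟩, ?_⟩
    rw [squareFun_top ⟨by linarith, by linarith⟩]
    ext <;> simp only <;> linarith
  · refine ⟨(7 - v.2) / 8, ⟨by linarith, by linarith⟩, ?_⟩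
    rw [squareFun_left ⟨by linarith, by linarith⟩]
    ext <;> simp only <;> linarith

/-- The corner `(-1, -1)`. -/
def corner : SquareBdry := ⟨squareFun 0, squareFun_mem (by simp)⟩

/-- The counterclockwise loop around the boundary of the square. -/
def squareLoop : Path corner corner where
  toFun t := ⟨squareFun t, squareFun_mem t.2⟩
  continuous_toFun := (continuous_squareFun.comp continuous_subtype_val).subtype_mk _
  source' := rfl
  target' := by
    apply Subtype.ext
    change squareFun 1 = squareFun 0
    rw [squareFun_left (by norm_num), squareFun_bottom (by norm_num)]
    norm_num

/-- A formula for `F` that is valid on all four edges. -/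
theorem fsFun_eq (a₁ a₂ b : ℝ) {v : ℝ × ℝ} (hv : v ∈ SquareBdry) :
    fsFun a₁ a₂ b v = (((a₁ - a₂) / 2 * (v.1 * v.2) + (a₁ + a₂) / 2, b), (1 - b) • v) := by
  obtain ⟨-, h⟩ := squareBdry_cases hv
  unfold fsFun
  split_ifs with h1 h2 h3
  · rw [h1]; ext <;> simp only; ring
  · rw [h2]; ext <;> simp only; ring
  · rw [h3]; ext <;> simp only; ring
  · have h4 : v.1 = -1 := by tauto
    rw [h4]; ext <;> simp only; ring

theorem continuous_fsMap {R a₁ a₂ b : ℝ} (h : Admissible R a₁ a₂ b) : Continuous (fsMap h) := by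
  apply Continuous.subtype_mk
  have : (fun v : SquareBdry => fsFun a₁ a₂ b v) = fun v : SquareBdry =>
      (((a₁ - a₂) / 2 * (v.1.1 * v.1.2) + (a₁ + a₂) / 2, b), (1 - b) • v.1) :=
    funext fun v => fsFun_eq a₁ a₂ b v.2
  rw [this]
  fun_prop

theorem fsMap_injective {R a₁ a₂ b : ℝ} (h : Admissible R a₁ a₂ b) :
    Function.Injective (fsMap h) := by
  intro v w hvw
  have h1 : (fsFun a₁ a₂ b v).2 = (fsFun a₁ a₂ b w).2 := by
    rw [show fsFun a₁ a₂ b v = fsFun a₁ a₂ b w from congrArg Subtype.val hvw]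
  rw [fsFun_snd, fsFun_snd] at h1
  exact Subtype.ext (smul_right_injective _ (by linarith [h.lt_one] : 1 - b ≠ 0) h1)

/-- `FS((a₁, b), (a₂, b))` as an oriented circle, parametrized by `F` along the boundary of the
square. -/
def fsKnot {R a₁ a₂ b : ℝ} (h : Admissible R a₁ a₂ b) : Knot R where
  base := fsMap h corner
  path := squareLoop.map (continuous_fsMap h)
  inj := by
    intro s hs t ht hst
    have h1 := congrArg Subtype.val (fsMap_injective h hst)
    refine Subtype.ext (squareFun_injOn ⟨s.2.1, ?_⟩ ⟨t.2.1, ?_⟩ h1)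
    · exact lt_of_le_of_ne s.2.2 fun h => hs (Subtype.ext h)
    · exact lt_of_le_of_ne t.2.2 fun h => ht (Subtype.ext h)

/-- The oriented circle has the underlying set `FS`. -/
theorem fsKnot_image {R a₁ a₂ b : ℝ} (h : Admissible R a₁ a₂ b) : (fsKnot h).image = FS h := by
  ext z
  constructor
  · rintro ⟨t, rfl⟩
    exact ⟨squareLoop t, rfl⟩
  · rintro ⟨v, rfl⟩
    obtain ⟨t, ht, htv⟩ := squareFun_surj v.2
    exact ⟨⟨t, ht⟩, congrArg (fsMap h) (Subtype.ext htv)⟩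

end FSLink

end

/-! `S(R, 1)` is the unit sphere of the norm `gnorm`, so statements about it can be moved by radial
projection to `TPlane` minus the origin, where positively homogeneous functions do the work.

Separation. The homogeneous function `height c` takes the constant value `b - c` on a circle at
level `b`. With `c` halfway between the two levels it has opposite signs on the two circles. Its
zero set is an embedded sphere because `shear` uses `height c` as a coordinate, is positively
homogeneous, and so induces a homeomorphism with the round sphere. Each side is connected, being the
projection of a cone that is star-shaped about a pole (`starConvex_height`). Disjointness also
follows from the values of `height`.

Linking number. The circle `γ'` lies on one side of `height b = 0`, while `γ` lies in that zero set.
As the side is star-shaped, `γ'` contracts in the complement of `γ`, so its class is trivial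
(`homologyClass_eq_one`). Hence 0 is a linking number, once a meridian and a path to it are
exhibited. For 0 to be the only one, every meridian must have infinite order in homology. The cone
over `FS` is the zero set of `coneFun : TPlane → ℂ`, so the change of `log coneFun` along loops is a
homomorphism on the first homology of the complement, and it must be shown nonzero on meridians
(`logChange_meridian_ne_zero`). The meridian bounds a disc with one zero of `coneFun`, at which the
derivative is injective on the plane of the disc. Shrinking the boundary ellipse leaves the change
of the logarithm fixed and makes `coneFun` close to its derivative, an odd function; the logarithm
of an odd loop never closes up (`log_ne_of_near_odd`). -/

noncomputable section

namespace FSLink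

section

/-! ### The change of the logarithm along a path -/

/-- Two continuous logarithms of the same function on a connected space differ by a constant. -/
theorem log_sub_eq {X : Type*} [TopologicalSpace X] [PreconnectedSpace X] {f g : X → ℂ}
    (hf : Continuous f) (hg : Continuous g) (h : ∀ x, Complex.exp (f x) = Complex.exp (g x))
    (x y : X) : f x - f y = g x - g y := by
  -- The difference, shifted to vanish at `x`, lifts the constant 1 through the covering `exp`;
  -- uniqueness of lifts makes it zero.
  have h1 : (fun z => f z - g z + (g x - f x)) = fun _ => (0 : ℂ) := by
    refine Complex.isCoveringMap_exp.eq_of_comp_eq (by fun_prop) (by fun_prop) ?_ x (by ring)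
    ext z
    simp [Complex.exp_add, Complex.exp_sub, h]
  have h2 := congrFun h1 y
  linear_combination -h2

variable {X : Type*} [TopologicalSpace X]

/-- The change of the logarithm of a nonvanishing function along a path. -/
def logChange (g : C(X, {w : ℂ // w ≠ 0})) {x y : X} (ω : Path x y) : ℂ :=
  Complex.isCoveringMap_exp.liftPath (g.comp ω.toContinuousMap) (Complex.log (g x).1)
      (Subtype.ext (by simp [Complex.exp_log (g x).2])) 1 - Complex.log (g x).1

variable (g : C(X, {w : ℂ // w ≠ 0})) {x y z : X}

theorem exists_log (ω : Path x y) : ∃ L : C(unitInterval, ℂ),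
    (∀ t, Complex.exp (L t) = (g (ω t)).1) ∧ logChange g ω = L 1 - L 0 := by
  have h0 : (g.comp ω.toContinuousMap) 0 =
      (fun z : ℂ ↦ (⟨_, z.exp_ne_zero⟩ : {z : ℂ // z ≠ 0})) (Complex.log (g x).1) :=
    Subtype.ext (by simp [Complex.exp_log (g x).2])
  refine ⟨Complex.isCoveringMap_exp.liftPath _ _ h0, fun t => ?_, ?_⟩
  · exact congrArg Subtype.val (congrFun (Complex.isCoveringMap_exp.liftPath_lifts _ _ h0) t)
  · rw [Complex.isCoveringMap_exp.liftPath_zero]; rfl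

/-- Any continuous branch computes the change, so later arguments never refer to the lift chosen in
the definition. -/
theorem logChange_eq (ω : Path x y) {L : unitInterval → ℂ} (hL : Continuous L)
    (h : ∀ t, Complex.exp (L t) = (g (ω t)).1) : logChange g ω = L 1 - L 0 := by
  obtain ⟨M, hM, hM'⟩ := exists_log g ω
  rw [hM']
  exact log_sub_eq M.continuous hL (fun t => by rw [hM, h]) 1 0

theorem logChange_congr {ω ω' : Path x y} (h : ω.Homotopic ω') :
    logChange g ω = logChange g ω' := by
  unfold logChange
  congr 1
  apply Complex.isCoveringMap_exp.liftPath_apply_one_eq_of_homotopicRel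
  exact ContinuousMap.HomotopicRel.comp_continuousMap h g

theorem logChange_trans (ω : Path x y) (ω' : Path y z) :
    logChange g (ω.trans ω') = logChange g ω + logChange g ω' := by
  obtain ⟨L, hL, hL'⟩ := exists_log g ω
  obtain ⟨M, hM, hM'⟩ := exists_log g ω'
  have h01 : Complex.exp (L 1) = Complex.exp (M 0) := by rw [hL, hM]; simp
  let P : Path (L 0) (L 1) := ⟨L, rfl, rfl⟩
  -- The second branch is shifted to start where the first ends; the shift has exponential 1, so the
  -- result is still a branch.
  let Q : Path (L 1) (M 1 + (L 1 - M 0)) := ⟨⟨fun t => M t + (L 1 - M 0), by fun_prop⟩,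
    by simp, rfl⟩
  rw [logChange_eq g (ω.trans ω') (P.trans Q).continuous, hL', hM']
  · simp only [Path.target, Path.source]; ring
  · intro t
    rw [Path.trans_apply, Path.trans_apply]
    split_ifs with ht
    · exact hL _
    · change Complex.exp (M _ + (L 1 - M 0)) = _
      rw [Complex.exp_add, Complex.exp_sub, h01, div_self (Complex.exp_ne_zero _), mul_one, hM]

theorem logChange_symm (ω : Path x y) : logChange g ω.symm = -logChange g ω := by
  obtain ⟨L, hL, hL'⟩ := exists_log g ω
  rw [logChange_eq g ω.symm (L := fun t => L (unitInterval.symm t)) (by fun_prop)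
    (fun t => by rw [hL]; rfl), hL']
  simp

/-- The change of the logarithm as a homomorphism on the fundamental group. -/
def logChangeHom (x : X) : FundamentalGroup X x →* Multiplicative ℂ :=
  MonoidHom.mk' (fun p => Multiplicative.ofAdd
    (Quotient.lift (fun ω : Path x x => logChange g ω) (fun _ _ h => logChange_congr g h)
      (FundamentalGroup.toPath p))) (by
    intro p q
    induction p using Quotient.inductionOn with | _ p
    induction q using Quotient.inductionOn with | _ q
    -- Multiplication in the fundamental group concatenates in the reverse order, which is harmless
    -- in a commutative target.
    change Multiplicative.ofAdd (logChange g (q.trans p)) = _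
    rw [logChange_trans, add_comm]
    rfl)

theorem logChangeHom_mk (ω : Path x x) :
    logChangeHom g x (FundamentalGroup.fromPath (Path.Homotopic.Quotient.mk ω)) =
      Multiplicative.ofAdd (logChange g ω) := rfl

/-- A loop that is freely homotopic to a loop of nonzero logarithmic change has infinite order in
the first homology group. -/
theorem eq_zero_of_zpow_eq_one (μ : Path y y) (β : Path x y) (hμ : logChange g μ ≠ 0) {n : ℤ}
    (h : (Abelianization.of (FundamentalGroup.fromPath
      (Path.Homotopic.Quotient.mk ((β.trans μ).trans β.symm)))) ^ n = 1) : n = 0 := by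
  -- The target is commutative, so the homomorphism descends to homology and the contributions of
  -- `β` and `β.symm` cancel.
  have h1 := congrArg (Abelianization.lift (logChangeHom g x)) h
  rw [map_zpow, Abelianization.lift_apply_of, map_one, logChangeHom_mk, logChange_trans,
    logChange_trans, logChange_symm, add_neg_cancel_comm, ← ofAdd_zsmul, ← ofAdd_zero] at h1
  have h2 := Multiplicative.ofAdd.injective h1
  rw [smul_eq_zero] at h2
  exact h2.resolve_right hμ

/-! ### The index of a zero of maximal rank -/

variable {E : Type*} [NormedAddCommGroup E] [NormedSpace ℝ E]

/-- The circle `cos (2πt) U + sin (2πt) V`. -/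
def circ (U V : E) (t : ℝ) : E :=
  Real.cos (2 * Real.pi * t) • U + Real.sin (2 * Real.pi * t) • V

theorem continuous_circ (U V : E) : Continuous (circ U V) := by
  unfold circ; fun_prop

theorem circ_add_one (U V : E) (t : ℝ) : circ U V (t + 1) = circ U V t := by
  unfold circ
  rw [mul_add, mul_one, Real.cos_add_two_pi, Real.sin_add_two_pi]

theorem circ_add_half (U V : E) (t : ℝ) : circ U V (t + 1 / 2) = -circ U V t := by
  unfold circ
  rw [show 2 * Real.pi * (t + 1 / 2) = 2 * Real.pi * t + Real.pi by ring, Real.cos_add_pi,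
    Real.sin_add_pi]
  module

theorem smul_circ (U V : E) (r t : ℝ) : r • circ U V t =
    (r * Real.cos (2 * Real.pi * t)) • U + (r * Real.sin (2 * Real.pi * t)) • V := by
  rw [circ, smul_add, smul_smul, smul_smul]

theorem sq_mul_cos_add_sq_mul_sin (r u : ℝ) :
    (r * Real.cos u) ^ 2 + (r * Real.sin u) ^ 2 = r ^ 2 := by
  rw [mul_pow, mul_pow, ← mul_add, Real.cos_sq_add_sin_sq, mul_one]

/-- A logarithm of a function on the real plane. -/
theorem exists_log_plane {H : ℝ × ℝ → ℂ} (hH : Continuous H) (h0 : ∀ x, H x ≠ 0) :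
    ∃ L : ℝ × ℝ → ℂ, Continuous L ∧ ∀ x, Complex.exp (L x) = H x := by
  obtain ⟨L, ⟨-, hL⟩, -⟩ := Complex.isCoveringMap_exp.existsUnique_continuousMap_lifts
    (⟨fun x => ⟨H x, h0 x⟩, by fun_prop⟩ : C(ℝ × ℝ, {w : ℂ // w ≠ 0})) (0, 0)
    (Complex.log (H (0, 0))) (Subtype.ext (by simp [Complex.exp_log (h0 _)]))
  exact ⟨L, L.continuous, fun x => congrArg Subtype.val (congrFun hL x)⟩

/-- Near a zero, a function is close to its derivative on a small ellipse. -/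
theorem exists_small_circle {Φ : E → ℂ} {D : E →L[ℝ] ℂ} {p U V : E}
    (hD : HasFDerivAt Φ D p) (hp : Φ p = 0)
    (hinj : ∀ s s' : ℝ, D (s • U + s' • V) = 0 → s = 0 ∧ s' = 0) :
    ∃ ε : ℝ, 0 < ε ∧ ε ≤ 1 ∧ ∀ t : ℝ,
      ‖Φ (p + ε • circ U V t) - D (ε • circ U V t)‖ < ‖D (ε • circ U V t)‖ := by
  have hne : ∀ t, D (circ U V t) ≠ 0 := fun t ht => by
    obtain ⟨h1, h2⟩ := hinj _ _ ht
    have := Real.cos_sq_add_sin_sq (2 * Real.pi * t)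
    rw [h1, h2] at this
    norm_num at this
  -- Periodicity reduces bounds on the whole line to extrema on the compact interval `[0, 1]`.
  have hper : ∀ t, circ U V t = circ U V (Int.fract t) := fun t => by
    have : Function.Periodic (circ U V) 1 := circ_add_one U V
    have h := this.sub_int_mul_eq (x := t) ⌊t⌋
    rw [mul_one, Int.self_sub_floor] at h
    exact h.symm
  have hc := continuous_circ U V
  obtain ⟨t₀, -, ht₀⟩ := isCompact_Icc.exists_isMinOn (s := Icc (0 : ℝ) 1) (by simp)
    (f := fun t => ‖D (circ U V t)‖) (by fun_prop)
  obtain ⟨t₁, -, ht₁⟩ := isCompact_Icc.exists_isMaxOn (s := Icc (0 : ℝ) 1) (by simp)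
    (f := fun t => ‖circ U V t‖) (by fun_prop)
  have hfr : ∀ t : ℝ, Int.fract t ∈ Icc (0 : ℝ) 1 :=
    fun t => ⟨Int.fract_nonneg t, (Int.fract_lt_one t).le⟩
  set κ := ‖D (circ U V t₀)‖
  set K := ‖circ U V t₁‖
  have hκ : 0 < κ := norm_pos_iff.2 (hne t₀)
  have hK : 0 ≤ K := norm_nonneg _
  have hκ' : ∀ t, κ ≤ ‖D (circ U V t)‖ := fun t => by rw [hper t]; exact ht₀ (hfr t)
  have hK' : ∀ t, ‖circ U V t‖ ≤ K := fun t => by rw [hper t]; exact ht₁ (hfr t)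
  -- With this tolerance the error at radius `ε` is at most `ε * κ / 2`, below the lower bound `ε *
  -- κ` for the derivative. Using `K + 1` avoids a zero denominator.
  have hlo := (hasFDerivAt_iff_isLittleO_nhds_zero.1 hD).def
    (show 0 < κ / (2 * (K + 1)) by positivity)
  obtain ⟨r, hr, hr'⟩ := Metric.eventually_nhds_iff.1 hlo
  refine ⟨min 1 (r / (2 * (K + 1))), by positivity, min_le_left _ _, fun t => ?_⟩
  set ε := min 1 (r / (2 * (K + 1)))
  have hε : 0 < ε := by positivity
  have h1 : ‖ε • circ U V t‖ ≤ ε * K := by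
    rw [norm_smul, Real.norm_of_nonneg hε.le]; gcongr; exact hK' t
  have h2 : ε * K < r := by
    calc ε * K ≤ r / (2 * (K + 1)) * K := by gcongr; exact min_le_right _ _
      _ < r := by rw [div_mul_eq_mul_div, div_lt_iff₀ (by positivity)]; nlinarith
  have h3 := hr' (y := ε • circ U V t) (by rw [dist_zero_right]; linarith)
  rw [hp, sub_zero] at h3
  have h4 : ‖D (ε • circ U V t)‖ = ε * ‖D (circ U V t)‖ := by
    rw [map_smul, norm_smul, Real.norm_of_nonneg hε.le]
  calc _ ≤ _ := h3
    _ ≤ κ / (2 * (K + 1)) * (ε * K) := by gcongr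
    _ = ε * κ * (K / (2 * (K + 1))) := by ring
    _ < ε * κ * 1 := by
        gcongr
        rw [div_lt_one (by positivity)]; linarith
    _ ≤ _ := by rw [h4, mul_one]; gcongr; exact hκ' t

/-- The logarithm of a loop is not a loop if the loop is close to an odd one. -/
theorem log_ne_of_near_odd {f d L : ℝ → ℂ} (hf : Continuous f) (hd : Continuous d)
    (hL : Continuous L) (hfL : ∀ t, Complex.exp (L t) = f t) (hodd : ∀ t, d (t + 1 / 2) = -d t)
    (hfd : ∀ t, ‖f t - d t‖ < ‖d t‖) (hper : f 1 = f 0) : L 1 ≠ L 0 := by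
  have hd0 : ∀ t, d t ≠ 0 := fun t h => by
    have := hfd t
    rw [h, norm_zero] at this
    exact absurd this (not_lt.2 (norm_nonneg _))
  -- The quotient stays within distance 1 of 1, so its principal logarithm is continuous and closed;
  -- subtracting it turns the branch `L` of `log f` into a branch `M` of `log d`.
  have hslit : ∀ t, f t / d t ∈ Complex.slitPlane := fun t => by
    have h1 : ‖f t / d t - 1‖ < 1 := by
      rw [div_sub_one (hd0 t), norm_div, div_lt_one (norm_pos_iff.2 (hd0 t))]
      exact hfd t
    left
    have h2 := (Complex.abs_re_le_norm _).trans_lt h1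
    rw [abs_lt, Complex.sub_re, Complex.one_re] at h2
    linarith [h2.1]
  have hf0 : ∀ t, f t ≠ 0 := fun t h => by rw [← hfL] at h; exact Complex.exp_ne_zero _ h
  have hlog : Continuous fun t => Complex.log (f t / d t) := (hf.div hd hd0).clog hslit
  have hd1 : d 1 = d 0 := by
    have h1 := hodd 0
    have h2 := hodd (1 / 2)
    norm_num at h1 h2
    rw [h2, h1, neg_neg]
  set M : ℝ → ℂ := fun t => L t - Complex.log (f t / d t) with hM
  have hMc : Continuous M := hL.sub hlog
  have hMd : ∀ t, Complex.exp (M t) = d t := fun t => by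
    rw [hM, Complex.exp_sub, hfL, Complex.exp_log (div_ne_zero (hf0 t) (hd0 t)),
      div_div_cancel₀ (hf0 t)]
  intro hL1
  have hM1 : M 1 = M 0 := by simp only [hM, hL1, hper, hd1]
  -- Oddness makes the half-period increment of `M` a logarithm of -1, hence a constant. If `M`
  -- closed up, twice that constant would be 0, although `exp 0` is not -1.
  have h1 : ∀ t, Complex.exp (M (t + 1 / 2) - M t) = -1 := fun t => by
    rw [Complex.exp_sub, hMd, hMd, hodd, neg_div, div_self (hd0 t)]
  have h2 := log_sub_eq (f := fun t => M (t + 1 / 2) - M t) (g := fun _ => M (0 + 1 / 2) - M 0)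
    (by fun_prop) (by fun_prop) (fun t => by rw [h1, h1]) (1 / 2) 0
  norm_num at h2
  have h3 := h1 0
  rw [hM1] at h2
  rw [show M (0 + 1 / 2) - M 0 = 0 by norm_num; linear_combination -h2 / 2, Complex.exp_zero] at h3
  norm_num at h3

/-- The logarithm of a function along an ellipse around a zero of maximal rank is not a loop, if
the zero is the only one in the elliptic disc. -/
theorem log_ne_of_rank {Φ : E → ℂ} (hΦ : Continuous Φ) {D : E →L[ℝ] ℂ} {p U V : E}
    (hD : HasFDerivAt Φ D p) (hp : Φ p = 0)
    (hinj : ∀ s s' : ℝ, D (s • U + s' • V) = 0 → s = 0 ∧ s' = 0)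
    (hdisc : ∀ s s' : ℝ, s ^ 2 + s' ^ 2 ≤ 1 → Φ (p + s • U + s' • V) = 0 → s = 0 ∧ s' = 0)
    {L : unitInterval → ℂ} (hL : Continuous L)
    (hLΦ : ∀ t : unitInterval, Complex.exp (L t) = Φ (p + circ U V t)) : L 1 ≠ L 0 := by
  obtain ⟨ε, hε, hε1, hsmall⟩ := exists_small_circle hD hp hinj
  have hc := continuous_circ U V
  -- Clamping the radius to `[ε, 1]` keeps the family of concentric ellipses off the zero for all
  -- real parameters, so one logarithm exists on the whole plane.
  set ρ : ℝ → ℝ := fun r => max ε (min 1 r)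
  have hρ0 : ρ 0 = ε := by simp [ρ, hε.le]
  have hρ1 : ρ 1 = 1 := by simp [ρ, hε1]
  have hρε : ∀ r, ε ≤ ρ r := fun r => le_max_left _ _
  have hρ1' : ∀ r, ρ r ≤ 1 := fun r => max_le hε1 (min_le_left _ _)
  obtain ⟨A, hA, hAH⟩ := exists_log_plane (H := fun x => Φ (p + ρ x.1 • circ U V x.2))
    (by fun_prop) (by
      intro x hx
      have hpos := hε.trans_le (hρε x.1)
      rw [smul_circ, ← add_assoc] at hx
      have hsq := sq_mul_cos_add_sq_mul_sin (ρ x.1) (2 * Real.pi * x.2)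
      obtain ⟨h1, h2⟩ := hdisc _ _ (by rw [hsq]; nlinarith [hρ1' x.1]) hx
      rw [h1, h2] at hsq
      nlinarith)
  have h1 : A (0, 1) ≠ A (0, 0) := by
    refine log_ne_of_near_odd (f := fun t => Φ (p + ε • circ U V t))
      (d := fun t => D (ε • circ U V t)) (L := fun t => A (0, t)) (by fun_prop) (by fun_prop)
      (by fun_prop) (fun t => ?_) (fun t => ?_) hsmall ?_
    · rw [hAH]; simp only [hρ0]
    · simp only [circ_add_half, smul_neg, map_neg]
    · rw [← circ_add_one U V 0, zero_add]
  -- `A` and its translate by one period are logarithms of the same function, so the increment over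
  -- a period is the same on the small and the large ellipse.
  have h2 := log_sub_eq (f := fun x : ℝ × ℝ => A (x.1, x.2 + 1)) (g := A) (by fun_prop) hA
    (fun x => by rw [hAH, hAH]; simp only [circ_add_one]) (1, 0) (0, 0)
  have h3 := log_sub_eq (f := L) (g := fun t : unitInterval => A (1, (t : ℝ))) hL (by fun_prop)
    (fun t => by rw [hLΦ, hAH]; simp only [hρ1, one_smul]) 1 0
  simp only [zero_add, Icc.coe_one, Icc.coe_zero] at h2 h3
  intro h4
  rw [h4, sub_self] at h3
  exact h1 (by linear_combination -h2 - h3)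

end

section

/-! ### The norm with unit sphere `S(R, 1)` -/

/-- The norm on the plane pairs whose unit sphere is `S(R, 1)`. -/
def gnorm (R : ℝ) (z : TPlane) : ℝ := max ((|z.1.1| + ‖z.2‖) / R) (|z.1.2| + ‖z.2‖)

theorem continuous_gnorm (R : ℝ) : Continuous (gnorm R) := by
  unfold gnorm; fun_prop

theorem gnorm_smul (R : ℝ) {c : ℝ} (hc : 0 ≤ c) (z : TPlane) :
    gnorm R (c • z) = c * gnorm R z := by
  simp only [gnorm, Prod.smul_fst, Prod.smul_snd, smul_eq_mul, abs_mul, norm_smul,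
    Real.norm_eq_abs, abs_of_nonneg hc]
  rw [mul_max_of_nonneg _ _ hc]
  congr 1 <;> ring

theorem gnorm_pos {R : ℝ} (hR : 0 < R) {z : TPlane} (hz : z ≠ 0) : 0 < gnorm R z := by
  by_contra! h
  have h1 := (le_max_left _ _).trans h
  have h2 := (le_max_right _ _).trans h
  rw [div_le_iff₀ hR, zero_mul] at h1
  have h3 := abs_nonneg z.1.1
  have h4 := abs_nonneg z.1.2
  have h5 := norm_nonneg z.2
  apply hz
  exact Prod.ext (Prod.ext (abs_eq_zero.1 (by linarith)) (abs_eq_zero.1 (by linarith)))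
    (norm_eq_zero.1 (by linarith))

theorem delta_eq (R : ℝ) (x : ℝ × ℝ) : delta R x = min (R - |x.1|) (1 - |x.2|) := by
  unfold delta
  congr 1
  · rcases abs_cases x.1 with ⟨h, h'⟩ | ⟨h, h'⟩ <;> rw [h]
    · rw [min_eq_right (by linarith)]
    · rw [min_eq_left (by linarith)]; ring
  · rcases abs_cases x.2 with ⟨h, h'⟩ | ⟨h, h'⟩ <;> rw [h]
    · rw [min_eq_right (by linarith)]
    · rw [min_eq_left (by linarith)]; ring

/-- By `delta_eq`, `‖y‖` is the smaller of `R - |x₁|` and `1 - |x₂|`; moving `‖y‖` across and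
dividing the first bound by `R` turns this minimum into a maximum equal to 1. -/
theorem mem_PLSphere {R : ℝ} (hR : 0 < R) {z : TPlane} : z ∈ PLSphere R ↔ gnorm R z = 1 := by
  have h5 := norm_nonneg z.2
  constructor
  · rintro ⟨-, h⟩
    rw [delta_eq] at h
    apply le_antisymm
    · refine max_le ?_ ?_
      · rw [div_le_one hR]; linarith [h.le.trans (min_le_left _ _)]
      · linarith [h.le.trans (min_le_right _ _)]
    · rcases min_choice (R - |z.1.1|) (1 - |z.1.2|) with h' | h' <;> rw [h'] at h
      · refine le_trans ?_ (le_max_left _ _)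
        rw [one_le_div hR]; linarith
      · refine le_trans ?_ (le_max_right _ _)
        linarith
  · intro h
    have h1 : (|z.1.1| + ‖z.2‖) / R ≤ 1 := (le_max_left _ _).trans h.le
    have h2 : |z.1.2| + ‖z.2‖ ≤ 1 := (le_max_right _ _).trans h.le
    rw [div_le_one hR] at h1
    refine ⟨⟨abs_le.1 (by linarith), abs_le.1 (by linarith)⟩, ?_⟩
    rw [delta_eq]
    apply le_antisymm (le_min (by linarith) (by linarith))
    rcases max_choice ((|z.1.1| + ‖z.2‖) / R) (|z.1.2| + ‖z.2‖) with h' | h' <;>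
      rw [gnorm, h'] at h
    · rw [div_eq_one_iff_eq hR.ne'] at h
      exact (min_le_left _ _).trans (by linarith)
    · exact (min_le_right _ _).trans (by linarith)

theorem ne_zero_of_mem {R : ℝ} (hR : 0 < R) {z : TPlane} (hz : z ∈ PLSphere R) : z ≠ 0 := by
  rintro rfl
  rw [mem_PLSphere hR] at hz
  simp [gnorm] at hz

/-- The radial projection of a nonzero vector to `S(R, 1)`. -/
def radial {R : ℝ} (hR : 0 < R) (z : TPlane) (hz : z ≠ 0) : PLSphere R :=
  ⟨(gnorm R z)⁻¹ • z, by
    have h := gnorm_pos hR hz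
    rw [mem_PLSphere hR, gnorm_smul _ (by positivity), inv_mul_cancel₀ h.ne']⟩

theorem radial_of_mem {R : ℝ} (hR : 0 < R) {z : TPlane} (hz : z ∈ PLSphere R) :
    radial hR z (ne_zero_of_mem hR hz) = ⟨z, hz⟩ := by
  apply Subtype.ext
  change (gnorm R z)⁻¹ • z = z
  rw [(mem_PLSphere hR).1 hz, inv_one, one_smul]

theorem continuous_radial {R : ℝ} (hR : 0 < R) {X : Type*} [TopologicalSpace X] {f : X → TPlane}
    (hf : Continuous f) (h0 : ∀ x, f x ≠ 0) : Continuous fun x => radial hR (f x) (h0 x) := by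
  apply Continuous.subtype_mk
  exact (((continuous_gnorm R).comp hf).inv₀ fun x => (gnorm_pos hR (h0 x)).ne').smul hf

/-! ### The homogeneous equation of `FS` -/

/-- A positively homogeneous height function, with the value `b' - b` on the circles `FS` at the
level `b'`. -/
def height (b : ℝ) (z : TPlane) : ℝ := (1 - b) * z.1.2 - b * ‖z.2‖

/-- A positively homogeneous function whose zero set is the cone over `FS`. -/
def coneFun (a₁ a₂ b : ℝ) (z : TPlane) : ℂ :=
  ((1 - b) * z.1.1 - (a₁ * |z.2.1 + z.2.2| + a₂ * |z.2.1 - z.2.2|) / 2 : ℝ) +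
    (height b z : ℝ) * Complex.I

theorem coneFun_re (a₁ a₂ b : ℝ) (z : TPlane) : (coneFun a₁ a₂ b z).re =
    (1 - b) * z.1.1 - (a₁ * |z.2.1 + z.2.2| + a₂ * |z.2.1 - z.2.2|) / 2 := by
  simp [coneFun, -Complex.ofReal_sub, -Complex.ofReal_div]

theorem coneFun_im (a₁ a₂ b : ℝ) (z : TPlane) : (coneFun a₁ a₂ b z).im = height b z := by
  simp [coneFun, -Complex.ofReal_sub, -Complex.ofReal_div]

theorem coneFun_eq_zero {a₁ a₂ b : ℝ} {z : TPlane} : coneFun a₁ a₂ b z = 0 ↔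
    (1 - b) * z.1.1 - (a₁ * |z.2.1 + z.2.2| + a₂ * |z.2.1 - z.2.2|) / 2 = 0 ∧ height b z = 0 := by
  rw [Complex.ext_iff, coneFun_re, coneFun_im]; rfl

theorem continuous_height (b : ℝ) : Continuous (height b) := by
  unfold height; fun_prop

theorem continuous_coneFun (a₁ a₂ b : ℝ) : Continuous (coneFun a₁ a₂ b) := by
  unfold coneFun height; fun_prop

theorem height_smul (b : ℝ) {c : ℝ} (hc : 0 ≤ c) (z : TPlane) :
    height b (c • z) = c * height b z := by
  simp only [height, Prod.smul_fst, Prod.smul_snd, smul_eq_mul, norm_smul, Real.norm_eq_abs,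
    abs_of_nonneg hc]
  ring

theorem coneFun_smul (a₁ a₂ b : ℝ) {c : ℝ} (hc : 0 ≤ c) (z : TPlane) :
    coneFun a₁ a₂ b (c • z) = c * coneFun a₁ a₂ b z := by
  rw [coneFun, height_smul _ hc, coneFun]
  simp only [Prod.smul_fst, Prod.smul_snd, smul_eq_mul, ← mul_add, ← mul_sub, abs_mul,
    abs_of_nonneg hc]
  push_cast
  ring

theorem coneFun_zero (a₁ a₂ b : ℝ) : coneFun a₁ a₂ b 0 = 0 := by
  simp [coneFun, height]

/-- This confines the non-smoothness of the maximum norm to the two diagonals, which meet the square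
boundary only at its corners. -/
theorem norm_eq_half (y : ℝ × ℝ) : ‖y‖ = (|y.1 + y.2| + |y.1 - y.2|) / 2 := by
  rw [Prod.norm_def, Real.norm_eq_abs, Real.norm_eq_abs]
  rcases abs_cases y.1 with ⟨h1, h1'⟩ | ⟨h1, h1'⟩ <;>
  rcases abs_cases y.2 with ⟨h2, h2'⟩ | ⟨h2, h2'⟩ <;>
  rcases abs_cases (y.1 + y.2) with ⟨h3, h3'⟩ | ⟨h3, h3'⟩ <;>
  rcases abs_cases (y.1 - y.2) with ⟨h4, h4'⟩ | ⟨h4, h4'⟩ <;>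
  rcases max_cases |y.1| |y.2| with ⟨h5, h5'⟩ | ⟨h5, h5'⟩ <;> linarith

/-- This replaces the quadratic term `v₁ v₂` in the formula for `F` by absolute values of linear
forms, and so makes the positively homogeneous equation `coneFun` possible. -/
theorem abs_add_of_squareBdry {v : ℝ × ℝ} (hv : v ∈ SquareBdry) :
    |v.1 + v.2| = 1 + v.1 * v.2 ∧ |v.1 - v.2| = 1 - v.1 * v.2 := by
  obtain ⟨⟨⟨h1, h2⟩, h3, h4⟩, h | h | h | h⟩ := squareBdry_cases hv <;> rw [h] <;> constructor
  · rw [abs_of_nonpos (by linarith)]; ring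
  · rw [abs_of_nonneg (by linarith)]; ring
  · rw [abs_of_nonneg (by linarith)]; ring
  · rw [abs_of_nonneg (by linarith)]; ring
  · rw [abs_of_nonneg (by linarith)]; ring
  · rw [abs_of_nonpos (by linarith)]; ring
  · rw [abs_of_nonpos (by linarith)]; ring
  · rw [abs_of_nonpos (by linarith)]; ring

variable {R a₁ a₂ b : ℝ}

theorem Admissible.pos (h : Admissible R a₁ a₂ b) : 0 < R := by
  linarith [h.abs_left, abs_nonneg a₁, h.lt_one]

/-- The points of `FS`, described without the parametrization. -/
theorem FS_spec (h : Admissible R a₁ a₂ b) {z : PLSphere R} (hz : z ∈ FS h) :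
    z.1.1 = ((a₁ - a₂) / 2 * (z.1.2.1 * z.1.2.2 / (1 - b) ^ 2) + (a₁ + a₂) / 2, b) ∧
      ‖z.1.2‖ = 1 - b := by
  obtain ⟨v, rfl⟩ := hz
  have hb := h.lt_one
  have hb' : 1 - b ≠ 0 := by linarith
  change (fsFun a₁ a₂ b v).1 = (_ * ((fsFun a₁ a₂ b v).2.1 * (fsFun a₁ a₂ b v).2.2 / _) + _, _) ∧
    ‖(fsFun a₁ a₂ b v).2‖ = _
  rw [fsFun_eq a₁ a₂ b v.2]
  constructor
  · simp only [Prod.smul_fst, Prod.smul_snd, smul_eq_mul]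
    ext
    · field_simp
    · rfl
  · simp only
    rw [norm_smul, mem_squareBdry.1 v.2, Real.norm_of_nonneg (by linarith), mul_one]

/-- For the converse, the equation fixes only a ray; the bounds on `a₁` and `a₂` show which part of
the unit sphere of `gnorm` that ray hits, and hence that `‖y‖ = 1 - b`. -/
theorem mem_FS_iff (h : Admissible R a₁ a₂ b) (z : PLSphere R) :
    z ∈ FS h ↔ coneFun a₁ a₂ b z = 0 := by
  have hb := h.lt_one
  have hb0 := h.nonneg
  have hR := h.pos
  rw [coneFun_eq_zero]
  constructor
  · rintro ⟨v, rfl⟩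
    change (1 - b) * (fsFun a₁ a₂ b v).1.1 - (a₁ * |(fsFun a₁ a₂ b v).2.1 + (fsFun a₁ a₂ b v).2.2| +
      a₂ * |(fsFun a₁ a₂ b v).2.1 - (fsFun a₁ a₂ b v).2.2|) / 2 = 0 ∧
      (1 - b) * (fsFun a₁ a₂ b v).1.2 - b * ‖(fsFun a₁ a₂ b v).2‖ = 0
    obtain ⟨h1, h2⟩ := abs_add_of_squareBdry v.2
    rw [fsFun_eq a₁ a₂ b v.2]
    simp only
    rw [norm_smul, mem_squareBdry.1 v.2, Real.norm_of_nonneg (by linarith)]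
    simp only [Prod.smul_fst, Prod.smul_snd, smul_eq_mul, ← mul_add, ← mul_sub, abs_mul, h1, h2,
      abs_of_pos (show 0 < 1 - b by linarith)]
    constructor <;> ring
  · rintro ⟨h1, h2⟩
    obtain ⟨z, hz⟩ := z
    simp only at h1 h2
    rw [mem_PLSphere hR] at hz
    rw [height] at h2
    have hn := norm_eq_half z.2
    set A := |z.2.1 + z.2.2|
    set B := |z.2.1 - z.2.2|
    set r := ‖z.2‖
    have hA : 0 ≤ A := abs_nonneg _
    have hB : 0 ≤ B := abs_nonneg _
    have hx2 : |z.1.2| = b * r / (1 - b) := by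
      rw [show z.1.2 = b * r / (1 - b) by rw [eq_div_iff (by linarith)]; linarith]
      exact abs_of_nonneg (div_nonneg (by positivity) (by linarith))
    have hx1 : (1 - b) * |z.1.1| ≤ r * (R - (1 - b)) := by
      rw [← abs_of_pos (show 0 < 1 - b by linarith), ← abs_mul, abs_of_pos (show 0 < 1 - b by linarith),
        show (1 - b) * z.1.1 = (a₁ * A + a₂ * B) / 2 by linarith]
      have e1 := abs_le.1 h.abs_left
      have e2 := abs_le.1 h.abs_right
      rw [abs_le]
      constructor <;> nlinarith
    -- Admissibility gives `|x₁| + r ≤ r R / (1 - b)`, and the right side over `R` is `|x₂| + r`. So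
    -- the second entry of the maximum is the active one, and setting it to 1 gives `r = 1 - b`.
    have hmax : (|z.1.1| + r) / R ≤ |z.1.2| + r := by
      rw [div_le_iff₀ hR, hx2, div_add' _ _ _ (by linarith : (1 - b) ≠ 0), div_mul_eq_mul_div,
        le_div_iff₀ (by linarith)]
      nlinarith
    rw [gnorm, max_eq_right hmax, hx2, div_add' _ _ _ (by linarith : (1 - b) ≠ 0),
      div_eq_one_iff_eq (by linarith)] at hz
    have hr : r = 1 - b := by linarith
    have hv : (1 - b)⁻¹ • z.2 ∈ SquareBdry := by
      rw [mem_squareBdry, norm_smul, norm_inv, Real.norm_of_nonneg (by linarith)]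
      change (1 - b)⁻¹ * r = 1
      rw [hr, inv_mul_cancel₀ (by linarith)]
    have hs : (1 - b) • (1 - b)⁻¹ • z.2 = z.2 := smul_inv_smul₀ (by linarith) _
    refine ⟨⟨_, hv⟩, Subtype.ext ?_⟩
    change fsFun a₁ a₂ b ((1 - b)⁻¹ • z.2) = z
    obtain ⟨e1, e2⟩ := abs_add_of_squareBdry hv
    have e3 : A = (1 - b) * (1 + ((1 - b)⁻¹ • z.2).1 * ((1 - b)⁻¹ • z.2).2) := by
      rw [← e1, ← abs_of_pos (show 0 < 1 - b by linarith), ← abs_mul,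
        abs_of_pos (show 0 < 1 - b by linarith), mul_add, ← smul_eq_mul (1 - b), ← Prod.smul_fst, hs,
        ← smul_eq_mul (1 - b), ← Prod.smul_snd, hs]
    have e4 : B = (1 - b) * (1 - ((1 - b)⁻¹ • z.2).1 * ((1 - b)⁻¹ • z.2).2) := by
      rw [← e2, ← abs_of_pos (show 0 < 1 - b by linarith), ← abs_mul,
        abs_of_pos (show 0 < 1 - b by linarith), mul_sub, ← smul_eq_mul (1 - b), ← Prod.smul_fst, hs,
        ← smul_eq_mul (1 - b), ← Prod.smul_snd, hs]
    rw [fsFun_eq a₁ a₂ b hv, hs]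
    have hb' : (1 - b) ≠ 0 := by linarith
    refine Prod.ext (Prod.ext ?_ ?_) rfl
    · apply mul_left_cancel₀ hb'
      simp only
      rw [show (1 - b) * z.1.1 = (a₁ * A + a₂ * B) / 2 by linarith, e3, e4]
      ring
    · apply mul_left_cancel₀ hb'
      simp only
      rw [hr] at h2
      linarith

/-! ### Differentiability along the edges -/

theorem differentiableAt_coneFun {z : TPlane} (h1 : z.2.1 + z.2.2 ≠ 0) (h2 : z.2.1 - z.2.2 ≠ 0) :
    DifferentiableAt ℝ (coneFun a₁ a₂ b) z := by
  have e : coneFun a₁ a₂ b = fun z : TPlane =>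
      Complex.ofRealCLM ((1 - b) * z.1.1 - (a₁ * |z.2.1 + z.2.2| + a₂ * |z.2.1 - z.2.2|) / 2) +
      Complex.ofRealCLM ((1 - b) * z.1.2 - b * ((|z.2.1 + z.2.2| + |z.2.1 - z.2.2|) / 2)) *
        Complex.I := by
    ext z
    rw [coneFun, height, norm_eq_half]; rfl
  have d1 : DifferentiableAt ℝ (fun z : TPlane => |z.2.1 + z.2.2|) z :=
    DifferentiableAt.abs (by fun_prop) h1
  have d2 : DifferentiableAt ℝ (fun z : TPlane => |z.2.1 - z.2.2|) z :=
    DifferentiableAt.abs (by fun_prop) h2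
  rw [e]
  fun_prop

/-- The function depends on `x` only through the term `(1 - b) (x₁ + i x₂)`. With
`fderiv_coneFun_right` this shows that the derivative has rank two. -/
theorem fderiv_coneFun_left {z : TPlane} {D : TPlane →L[ℝ] ℂ}
    (hD : HasFDerivAt (coneFun a₁ a₂ b) D z) : D ((1, 0), 0) = ((1 - b : ℝ) : ℂ) := by
  have h1 : HasDerivAt (fun t : ℝ => z + t • (((1, 0), 0) : TPlane)) ((1, 0), 0) 0 := by
    simpa using ((hasDerivAt_id (0 : ℝ)).smul_const (((1, 0), 0) : TPlane)).const_add z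
  have h2 := HasFDerivAt.comp_hasDerivAt (0 : ℝ) (f := fun t : ℝ => z + t • (((1, 0), 0) : TPlane))
    (by simpa using hD) h1
  have h3 : (coneFun a₁ a₂ b ∘ fun t : ℝ => z + t • (((1, 0), 0) : TPlane)) =
      fun t : ℝ => coneFun a₁ a₂ b z + (t : ℂ) * ((1 - b : ℝ) : ℂ) := by
    ext t
    simp only [Function.comp_apply, coneFun, height, Prod.fst_add, Prod.snd_add, Prod.smul_fst,
      Prod.smul_snd, smul_zero, add_zero, smul_eq_mul, mul_one, mul_zero]
    push_cast; ring
  rw [h3] at h2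
  refine h2.unique ?_
  simpa using ((hasDerivAt_id (0 : ℝ)).ofReal_comp.mul_const ((1 - b : ℝ) : ℂ)).const_add
    (coneFun a₁ a₂ b z)

theorem fderiv_coneFun_right {z : TPlane} {D : TPlane →L[ℝ] ℂ}
    (hD : HasFDerivAt (coneFun a₁ a₂ b) D z) :
    D ((0, 1), 0) = ((1 - b : ℝ) : ℂ) * Complex.I := by
  have h1 : HasDerivAt (fun t : ℝ => z + t • (((0, 1), 0) : TPlane)) ((0, 1), 0) 0 := by
    simpa using ((hasDerivAt_id (0 : ℝ)).smul_const (((0, 1), 0) : TPlane)).const_add z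
  have h2 := HasFDerivAt.comp_hasDerivAt (0 : ℝ) (f := fun t : ℝ => z + t • (((0, 1), 0) : TPlane))
    (by simpa using hD) h1
  have h3 : (coneFun a₁ a₂ b ∘ fun t : ℝ => z + t • (((0, 1), 0) : TPlane)) =
      fun t : ℝ => coneFun a₁ a₂ b z + (t : ℂ) * (((1 - b : ℝ) : ℂ) * Complex.I) := by
    ext t
    simp only [Function.comp_apply, coneFun, height, Prod.fst_add, Prod.snd_add, Prod.smul_fst,
      Prod.smul_snd, smul_zero, add_zero, smul_eq_mul, mul_one, mul_zero]
    push_cast; ring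
  rw [h3] at h2
  refine h2.unique ?_
  simpa using ((hasDerivAt_id (0 : ℝ)).ofReal_comp.mul_const
    (((1 - b : ℝ) : ℂ) * Complex.I)).const_add (coneFun a₁ a₂ b z)

/-- By homogeneity a zero persists along its ray, so the radial derivative vanishes. -/
theorem fderiv_coneFun_self {z : TPlane} {D : TPlane →L[ℝ] ℂ}
    (hD : HasFDerivAt (coneFun a₁ a₂ b) D z) (hz : coneFun a₁ a₂ b z = 0) : D z = 0 := by
  have h1 : HasDerivAt (fun t : ℝ => t • z) z 1 := by
    simpa using (hasDerivAt_id (1 : ℝ)).smul_const z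
  have h2 := HasFDerivAt.comp_hasDerivAt (1 : ℝ) (f := fun t : ℝ => t • z) (by simpa using hD) h1
  refine h2.unique ((hasDerivAt_const (1 : ℝ) (0 : ℂ)).congr_of_eventuallyEq ?_)
  filter_upwards [eventually_gt_nhds (zero_lt_one (α := ℝ))] with t ht
  simp only [Function.comp_apply]
  rw [coneFun_smul _ _ _ ht.le, hz, mul_zero]

/-! ### ### The determinant of a frame -/

theorem det4_eq (p q r s : TPlane) : Knot.det4 p q r s =
      p.1.1 * (q.1.2 * (r.2.1 * s.2.2 - r.2.2 * s.2.1) -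
        q.2.1 * (r.1.2 * s.2.2 - r.2.2 * s.1.2) +
        q.2.2 * (r.1.2 * s.2.1 - r.2.1 * s.1.2)) -
      p.1.2 * (q.1.1 * (r.2.1 * s.2.2 - r.2.2 * s.2.1) -
        q.2.1 * (r.1.1 * s.2.2 - r.2.2 * s.1.1) +
        q.2.2 * (r.1.1 * s.2.1 - r.2.1 * s.1.1)) +
      p.2.1 * (q.1.1 * (r.1.2 * s.2.2 - r.2.2 * s.1.2) -
        q.1.2 * (r.1.1 * s.2.2 - r.2.2 * s.1.1) +
        q.2.2 * (r.1.1 * s.1.2 - r.1.2 * s.1.1)) -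
      p.2.2 * (q.1.1 * (r.1.2 * s.2.1 - r.2.1 * s.1.2) -
        q.1.2 * (r.1.1 * s.2.1 - r.2.1 * s.1.1) +
        q.2.1 * (r.1.1 * s.1.2 - r.1.2 * s.1.1)) := by
  rw [Knot.det4, Matrix.det_succ_row_zero]
  simp [Fin.sum_univ_succ, Matrix.det_fin_three, Fin.succAbove]
  ring

/-- Three vectors in the kernel of a map of rank two are linearly dependent. -/
theorem det4_eq_zero {D : TPlane →L[ℝ] ℂ} {κ : ℝ} (hκ : κ ≠ 0) (h1 : D ((1, 0), 0) = (κ : ℂ))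
    (h2 : D ((0, 1), 0) = (κ : ℂ) * Complex.I) {p q r : TPlane} (hp : D p = 0) (hq : D q = 0)
    (hr : D r = 0) (s : TPlane) : Knot.det4 p q r s = 0 := by
  -- On the kernel the `x` part is a fixed linear function of the two `y` coordinates; substituting
  -- this makes the determinant vanish identically.
  have key : ∀ z : TPlane, D z = 0 →
      z.1.1 = -(z.2.1 * (D (0, (1, 0))).re + z.2.2 * (D (0, (0, 1))).re) / κ ∧
      z.1.2 = -(z.2.1 * (D (0, (1, 0))).im + z.2.2 * (D (0, (0, 1))).im) / κ := by
    intro z hz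
    have hz' : z = z.1.1 • (((1, 0), 0) : TPlane) + z.1.2 • (((0, 1), 0) : TPlane) +
        z.2.1 • ((0, (1, 0)) : TPlane) + z.2.2 • ((0, (0, 1)) : TPlane) := by
      ext <;> simp
    rw [hz', map_add, map_add, map_add, map_smul, map_smul, map_smul, map_smul, h1, h2,
      Complex.ext_iff] at hz
    simp only [Complex.add_re, Complex.add_im, Complex.smul_re, Complex.smul_im, smul_eq_mul,
      Complex.re_ofReal_mul, Complex.im_ofReal_mul, Complex.ofReal_re, Complex.ofReal_im,
      Complex.I_re, Complex.I_im, Complex.zero_re, Complex.zero_im] at hz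
    constructor <;> rw [eq_div_iff hκ] <;> linarith [hz.1, hz.2]
  obtain ⟨p1, p2⟩ := key p hp
  obtain ⟨q1, q2⟩ := key q hq
  obtain ⟨r1, r2⟩ := key r hr
  rw [det4_eq, p1, p2, q1, q2, r1, r2]
  ring

theorem det4_add_smul (p q r s : TPlane) (c d : ℝ) :
    Knot.det4 p q (c • r + d • s) s = c * Knot.det4 p q r s ∧
    Knot.det4 p q r (c • r + d • s) = d * Knot.det4 p q r s := by
  simp only [det4_eq, Prod.fst_add, Prod.snd_add, Prod.smul_fst, Prod.smul_snd, smul_eq_mul]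
  constructor <;> ring

end

section

variable {R a₁ a₂ b : ℝ}

/-! ### The complement of `FS` -/

theorem coneFun_eq_zero_of_mem (h : Admissible R a₁ a₂ b) {γ : Knot R} (hγ : γ.image = FS h)
    {z : PLSphere R} (hz : z ∈ γ.image) : coneFun a₁ a₂ b z = 0 := by
  rw [hγ] at hz
  exact (mem_FS_iff h z).1 hz

theorem coneFun_ne_zero (h : Admissible R a₁ a₂ b) {γ : Knot R} (hγ : γ.image = FS h)
    (z : γ.Compl) : coneFun a₁ a₂ b z.1 ≠ 0 := by
  rw [Ne, ← mem_FS_iff h, ← hγ]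
  exact z.2

theorem ne_zero_of_coneFun {z : TPlane} (hz : coneFun a₁ a₂ b z ≠ 0) : z ≠ 0 := by
  rintro rfl
  exact hz (coneFun_zero _ _ _)

/-- The equation of `FS`, as a map to the punctured plane. -/
def complMap (h : Admissible R a₁ a₂ b) {γ : Knot R} (hγ : γ.image = FS h) :
    C(γ.Compl, {w : ℂ // w ≠ 0}) :=
  ⟨fun z => ⟨coneFun a₁ a₂ b z.1, coneFun_ne_zero h hγ z⟩,
    (((continuous_coneFun a₁ a₂ b).comp continuous_subtype_val).comp
      continuous_subtype_val).subtype_mk _⟩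

theorem radial_notMem (h : Admissible R a₁ a₂ b) {γ : Knot R} (hγ : γ.image = FS h) {z : TPlane}
    (hz : coneFun a₁ a₂ b z ≠ 0) : radial h.pos z (ne_zero_of_coneFun hz) ∉ γ.image := by
  intro hmem
  have h1 := coneFun_eq_zero_of_mem h hγ hmem
  have h2 := inv_pos.2 (gnorm_pos h.pos (ne_zero_of_coneFun hz))
  change coneFun a₁ a₂ b ((gnorm R z)⁻¹ • z) = 0 at h1
  rw [coneFun_smul _ _ _ h2.le, mul_eq_zero] at h1
  exact h1.elim (fun e => h2.ne' (Complex.ofReal_eq_zero.1 e)) hz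

/-- The radial projection to the complement of `FS`. -/
def complRadial (h : Admissible R a₁ a₂ b) {γ : Knot R} (hγ : γ.image = FS h) :
    C({z : TPlane // coneFun a₁ a₂ b z ≠ 0}, γ.Compl) :=
  ⟨fun z => ⟨radial h.pos z.1 (ne_zero_of_coneFun z.2), radial_notMem h hγ z.2⟩,
    (continuous_radial h.pos continuous_subtype_val _).subtype_mk _⟩

theorem complRadial_of_mem (h : Admissible R a₁ a₂ b) {γ : Knot R} (hγ : γ.image = FS h)
    (z : γ.Compl) : complRadial h hγ ⟨z.1.1, coneFun_ne_zero h hγ z⟩ = z :=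
  Subtype.ext (radial_of_mem h.pos z.1.2)

theorem extend_mem (γ : Knot R) (t : ℝ) : γ.path.extend t ∈ γ.image := by
  rw [Knot.image, ← γ.path.extend_range]
  exact mem_range_self t

/-! ### Meridians have nonzero index -/

/-- A function that takes an extremal value `± m` has derivative zero there. -/
theorem deriv_eq_zero_of_abs_le {f : ℝ → ℝ} {f' m t₀ : ℝ} (hf : HasDerivAt f f' t₀)
    (hle : ∀ t, |f t| ≤ m) (h0 : |f t₀| = m) : f' = 0 := by
  rcases abs_cases (f t₀) with ⟨h1, -⟩ | ⟨h1, -⟩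
  · have hmax : IsLocalMax f t₀ := Filter.Eventually.of_forall fun t => by
      linarith [(abs_le.1 (hle t)).2]
    exact hmax.hasDerivAt_eq_zero hf
  · have hmin : IsLocalMin f t₀ := Filter.Eventually.of_forall fun t => by
      linarith [(abs_le.1 (hle t)).1]
    exact hmin.hasDerivAt_eq_zero hf

/-- A parametrization of `FS` has velocity zero at the corners. -/
theorem velocity_corner (h : Admissible R a₁ a₂ b) {γ : Knot R} (hγ : γ.image = FS h) {t₀ : ℝ}
    {τ : TPlane} (hτ : HasDerivAt (fun t : ℝ => (γ.path.extend t : TPlane)) τ t₀)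
    (hc : |(γ.path.extend t₀ : TPlane).2.1| = |(γ.path.extend t₀ : TPlane).2.2|) : τ = 0 := by
  have hspec : ∀ t, _ := fun t => FS_spec h (hγ ▸ extend_mem γ t)
  set c : ℝ → TPlane := fun t => (γ.path.extend t : TPlane) with hcdef
  change |(c t₀).2.1| = |(c t₀).2.2| at hc
  change ∀ t, (c t).1 = ((a₁ - a₂) / 2 * ((c t).2.1 * (c t).2.2 / (1 - b) ^ 2) + (a₁ + a₂) / 2, b) ∧
    ‖(c t).2‖ = 1 - b at hspec
  have hx := hasFDerivAt_fst.comp_hasDerivAt t₀ hτ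
  have hy := hasFDerivAt_snd.comp_hasDerivAt t₀ hτ
  have hx1 : HasDerivAt (fun t => (c t).1.1) τ.1.1 t₀ :=
    HasFDerivAt.comp_hasDerivAt t₀ (hasFDerivAt_fst (𝕜 := ℝ) (E := ℝ) (F := ℝ)) hx
  have hx2 : HasDerivAt (fun t => (c t).1.2) τ.1.2 t₀ :=
    HasFDerivAt.comp_hasDerivAt t₀ (hasFDerivAt_snd (𝕜 := ℝ) (E := ℝ) (F := ℝ)) hx
  have hy1 : HasDerivAt (fun t => (c t).2.1) τ.2.1 t₀ :=
    HasFDerivAt.comp_hasDerivAt t₀ (hasFDerivAt_fst (𝕜 := ℝ) (E := ℝ) (F := ℝ)) hy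
  have hy2 : HasDerivAt (fun t => (c t).2.2) τ.2.2 t₀ :=
    HasFDerivAt.comp_hasDerivAt t₀ (hasFDerivAt_snd (𝕜 := ℝ) (E := ℝ) (F := ℝ)) hy
  have hn : ∀ t, max |(c t).2.1| |(c t).2.2| = 1 - b := fun t => (hspec t).2
  -- At a corner both `|y₁|` and `|y₂|` attain their maximum `1 - b`, so both derivatives vanish;
  -- `x` is a function of `y₁ y₂`, so its derivative vanishes too.
  have e1 : τ.2.1 = 0 := deriv_eq_zero_of_abs_le hy1 (m := 1 - b)
    (fun t => (le_max_left _ _).trans (hn t).le) (by rw [← hn t₀, hc, max_self])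
  have e2 : τ.2.2 = 0 := deriv_eq_zero_of_abs_le hy2 (m := 1 - b)
    (fun t => (le_max_right _ _).trans (hn t).le) (by rw [← hn t₀, hc, max_self])
  have e3 : τ.1.2 = 0 := by
    refine hx2.unique ((hasDerivAt_const t₀ b).congr_of_eventuallyEq ?_)
    exact Filter.Eventually.of_forall fun t => by simp only [(hspec t).1]
  have e4 : τ.1.1 = 0 := by
    have h1 := (((hy1.mul hy2).div_const ((1 - b) ^ 2)).const_mul ((a₁ - a₂) / 2)).add_const
      ((a₁ + a₂) / 2)
    rw [e1, e2] at h1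
    refine hx1.unique ((h1.congr_of_eventuallyEq ?_).congr_deriv (by ring))
    exact Filter.Eventually.of_forall fun t => by simp only [(hspec t).1, Pi.mul_apply]
  exact Prod.ext (Prod.ext e4 e3) (Prod.ext e1 e2)

/-- A positive frame has `τ ≠ 0`, so `p` is not a corner and `coneFun` is differentiable there. The
derivative has rank two and kills `p` and `τ`, so it is injective on the span of `U` and `V`, and
`log_ne_of_rank` applies to the flat disc. -/
theorem logChange_meridian_ne_zero (h : Admissible R a₁ a₂ b) {γ : Knot R} (hγ : γ.image = FS h)
    {m : γ.Compl} {μ : Path m m} (hμ : γ.IsMeridian μ) : logChange (complMap h hγ) μ ≠ 0 := by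
  obtain ⟨t₀, -, p, τ, U, V, hp, hτ, hdet, hdisc, hrun⟩ := hμ
  have hb := h.lt_one
  have hpmem := extend_mem γ t₀
  have hp0 : coneFun a₁ a₂ b p = 0 := by rw [← hp]; exact coneFun_eq_zero_of_mem h hγ hpmem
  have hτ0 : τ ≠ 0 := by
    rintro rfl
    simp [det4_eq] at hdet
  have hcorner : |p.2.1| ≠ |p.2.2| := fun e =>
    hτ0 (velocity_corner h hγ hτ (by rw [hp]; exact e))
  rw [Ne, abs_eq_abs, not_or] at hcorner
  obtain ⟨D, hD⟩ : ∃ D, HasFDerivAt (coneFun a₁ a₂ b) D p := (differentiableAt_coneFun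
    (fun e => hcorner.2 (by linarith)) (fun e => hcorner.1 (by linarith)))
  have hDp : D p = 0 := fderiv_coneFun_self hD hp0
  have hDτ : D τ = 0 := by
    have h1 := HasFDerivAt.comp_hasDerivAt t₀ (f := fun t : ℝ => (γ.path.extend t : TPlane))
      (by rw [hp]; exact hD) hτ
    refine h1.unique ((hasDerivAt_const t₀ (0 : ℂ)).congr_of_eventuallyEq ?_)
    exact Filter.Eventually.of_forall fun t => coneFun_eq_zero_of_mem h hγ (extend_mem γ t)
  have hinj : ∀ s s' : ℝ, D (s • U + s' • V) = 0 → s = 0 ∧ s' = 0 := by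
    intro s s' hs
    have key := det4_eq_zero (sub_ne_zero.2 hb.ne') (fderiv_coneFun_left hD)
      (fderiv_coneFun_right hD) hDp hDτ hs
    constructor
    · have h1 := key V
      rw [(det4_add_smul _ _ _ _ _ _).1] at h1
      exact (mul_eq_zero.1 h1).resolve_right hdet.ne'
    · have h1 := key U
      have h2 : Knot.det4 p τ (s • U + s' • V) U = -(s' * Knot.det4 p τ U V) := by
        simp only [det4_eq, Prod.fst_add, Prod.snd_add, Prod.smul_fst, Prod.smul_snd, smul_eq_mul]
        ring
      rw [h2, neg_eq_zero] at h1
      exact (mul_eq_zero.1 h1).resolve_right hdet.ne'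
  -- Adding multiples of `U` and `V` to the first row leaves the positive determinant unchanged, so
  -- the flat disc avoids the origin and can be projected.
  have hne : ∀ s s' : ℝ, p + s • U + s' • V ≠ 0 := by
    intro s s' e
    have h1 : Knot.det4 (p + s • U + s' • V) τ U V = Knot.det4 p τ U V := by
      simp only [det4_eq, Prod.fst_add, Prod.snd_add, Prod.smul_fst, Prod.smul_snd, smul_eq_mul]
      ring
    rw [e] at h1
    simp [det4_eq] at h1
    simp only [det4_eq] at hdet
    linarith
  have hzero : ∀ s s' : ℝ, s ^ 2 + s' ^ 2 ≤ 1 → coneFun a₁ a₂ b (p + s • U + s' • V) = 0 →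
      s = 0 ∧ s' = 0 := by
    intro s s' hs e
    have hpos := inv_pos.2 (gnorm_pos h.pos (hne s s'))
    refine hdisc s s' hs _ hpos (radial h.pos _ (hne s s')) ?_ rfl
    rw [hγ, mem_FS_iff]
    change coneFun a₁ a₂ b (_ • _) = 0
    rw [coneFun_smul _ _ _ hpos.le, e, mul_zero]
  have hcirc : ∀ t : ℝ, p + circ U V t = p + Real.cos (2 * Real.pi * t) • U +
      Real.sin (2 * Real.pi * t) • V := fun t => by rw [circ, add_assoc]
  have hposN : ∀ t : ℝ, 0 < gnorm R (p + circ U V t) := fun t => by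
    rw [hcirc]; exact gnorm_pos h.pos (hne _ _)
  have hμt : ∀ t : unitInterval, coneFun a₁ a₂ b (p + circ U V t) =
      gnorm R (p + circ U V t) * coneFun a₁ a₂ b (μ t).1 := by
    intro t
    obtain ⟨c, hc, hct⟩ := hrun t
    rw [← hcirc] at hct
    have h1 := (mem_PLSphere h.pos).1 (μ t).1.2
    rw [hct, gnorm_smul _ hc.le] at h1
    rw [hct, coneFun_smul _ _ _ hc.le, ← mul_assoc, ← Complex.ofReal_mul, mul_comm _ c, h1]
    simp
  obtain ⟨L, hL, hL'⟩ := exists_log (complMap h hγ) μ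
  have hcontN : Continuous fun t : unitInterval => gnorm R (p + circ U V t) :=
    (continuous_gnorm R).comp (by have := continuous_circ U V; fun_prop)
  -- The flat ellipse differs from the meridian by the positive factor `gnorm`. Its real logarithm
  -- has equal values at both ends, so it does not affect whether the branch closes up.
  have h1 := log_ne_of_rank (continuous_coneFun a₁ a₂ b) hD hp0 hinj hzero
    (L := fun t => L t + (Real.log (gnorm R (p + circ U V t)) : ℝ))
    (L.continuous.add (Complex.continuous_ofReal.comp (hcontN.log fun t => (hposN t).ne')))
    (fun t => by
      rw [Complex.exp_add, hL, ← Complex.ofReal_exp, Real.exp_log (hposN t), hμt, mul_comm]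
      rfl)
  rw [hL', sub_ne_zero]
  intro e
  apply h1
  have h2 := circ_add_one U V 0
  rw [zero_add] at h2
  simp only [e, Icc.coe_one, Icc.coe_zero, h2]

/-! ### Existence of a meridian -/

/-- A circle around a point at which the velocity is horizontal and along the first coordinate of
the tangent vector. -/
theorem exists_meridian (h : Admissible R a₁ a₂ b) {γ : Knot R} (hγ : γ.image = FS h) {t₀ : ℝ}
    (ht₀ : t₀ ∈ Ioo (0 : ℝ) 1) {x y u κ : ℝ} (hy : y ≠ 0)
    (hp : (γ.path.extend t₀ : TPlane) = ((x, b), (0, y)))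
    (hτ : HasDerivAt (fun t : ℝ => (γ.path.extend t : TPlane)) ((u, 0), (κ, 0)) t₀) (hκ : κ ≠ 0) :
    ∃ (hz : coneFun a₁ a₂ b ((x, b + 1), (0, y)) ≠ 0)
      (μ : Path (complRadial h hγ ⟨_, hz⟩) (complRadial h hγ ⟨_, hz⟩)), γ.IsMeridian μ := by
  have hb := h.lt_one
  have hp0 : coneFun a₁ a₂ b ((x, b), (0, y)) = 0 := by
    rw [← hp]; exact coneFun_eq_zero_of_mem h hγ (extend_mem γ t₀)
  -- The factor `y * κ` in `V` makes the determinant `(y * κ) ^ 2`, positive for either direction of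
  -- travel. Since `U` and `V` leave `y` unchanged, `coneFun` is affine and injective on the plane
  -- of the disc.
  set U : TPlane := ((0, 1), (0, 0)) with hU
  set V : TPlane := ((y * κ, 0), (0, 0)) with hV
  have hzero : ∀ s s' : ℝ, coneFun a₁ a₂ b (((x, b), (0, y)) + s • U + s' • V) = 0 →
      s = 0 ∧ s' = 0 := by
    intro s s' e
    rw [coneFun_eq_zero] at e hp0
    simp [hU, hV, height] at e hp0
    obtain ⟨e1, e2⟩ := e
    obtain ⟨p1, p2⟩ := hp0
    constructor
    · have : (1 - b) * s = 0 := by linarith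
      exact (mul_eq_zero.1 this).resolve_left (by linarith)
    · have : (1 - b) * (s' * (y * κ)) = 0 := by linarith
      rcases mul_eq_zero.1 this with h1 | h1
      · linarith
      · exact (mul_eq_zero.1 h1).resolve_right (mul_ne_zero hy hκ)
  have hne : ∀ t : ℝ, coneFun a₁ a₂ b (((x, b), (0, y)) + circ U V t) ≠ 0 := by
    intro t e
    rw [circ, ← add_assoc] at e
    obtain ⟨h1, h2⟩ := hzero _ _ e
    have := Real.cos_sq_add_sin_sq (2 * Real.pi * t)
    rw [h1, h2] at this
    norm_num at this
  have hbase : (((x, b), (0, y)) : TPlane) + circ U V 0 = ((x, b + 1), (0, y)) := by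
    simp [circ, hU]
  have hc := continuous_circ U V
  refine ⟨hbase ▸ hne 0, ⟨⟨fun t => complRadial h hγ ⟨_, hne t⟩, ?_⟩, ?_, ?_⟩, t₀, ht₀,
    ((x, b), (0, y)), ((u, 0), (κ, 0)), U, V, hp, hτ, ?_, ?_, ?_⟩
  · exact (complRadial h hγ).continuous.comp
      (Continuous.subtype_mk (by fun_prop) _)
  · simp only [Icc.coe_zero, hbase]
  · have h1 := circ_add_one U V 0
    rw [zero_add] at h1
    simp only [Icc.coe_one, h1, hbase]
  · have : 0 < (y * κ) ^ 2 := by have := mul_ne_zero hy hκ; positivity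
    simp [det4_eq, hU, hV]
    nlinarith
  · intro s s' _ c hc z hz e
    have h1 := coneFun_eq_zero_of_mem h hγ hz
    rw [e, coneFun_smul _ _ _ hc.le, mul_eq_zero] at h1
    exact hzero s s' (h1.resolve_left fun e => hc.ne' (Complex.ofReal_eq_zero.1 e))
  · intro t
    refine ⟨_, inv_pos.2 (gnorm_pos h.pos (ne_zero_of_coneFun (hne t))), ?_⟩
    rw [add_assoc]
    rfl

/-! ### Loops off the level of `FS` are null-homologous -/

theorem homotopic_refl_of_lift {X Y : Type*} [TopologicalSpace X] [TopologicalSpace Y]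
    [SimplyConnectedSpace X] (F : C(X, Y)) {x : X} {q : Y} (α' : Path x x) (α : Path q q)
    (hα : ∀ t, F (α' t) = α t) : α.Homotopic (Path.refl q) := by
  have hq : F x = q := by simpa using hα 0
  subst hq
  have h1 : α = α'.map F.continuous := by ext t; exact (hα t).symm
  rw [h1]
  exact (SimplyConnectedSpace.paths_homotopic α' (Path.refl x)).map F

/-- The pole has `y = 0`, so the norm of `y` scales linearly along segments to it and `height` is
affine there. The side `height < 0` need not be convex, hence star-shapedness. -/
theorem starConvex_height (hb : b < 1) {σ : ℝ} (hσ : σ = 1 ∨ σ = -1) :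
    StarConvex ℝ (((0, σ), 0) : TPlane) {z | 0 < σ * height b z} := by
  intro z hz r s hr hs hrs
  simp only [mem_ofPred_eq] at hz ⊢
  have e1 : (r • (((0, σ), 0) : TPlane) + s • z).1.2 = r * σ + s * z.1.2 := by simp
  have e2 : ‖(r • (((0, σ), 0) : TPlane) + s • z).2‖ = s * ‖z.2‖ := by
    simp [norm_smul, abs_of_nonneg hs]
  rw [height] at hz ⊢
  rw [e1, e2]
  have hσ2 : σ * σ = 1 := by rcases hσ with rfl | rfl <;> norm_num
  have e3 : σ * ((1 - b) * (r * σ + s * z.1.2) - b * (s * ‖z.2‖)) =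
      r * (1 - b) + s * (σ * ((1 - b) * z.1.2 - b * ‖z.2‖)) := by
    linear_combination (1 - b) * r * hσ2
  rw [e3]
  rcases hr.eq_or_lt with rfl | hr
  · rw [show s = 1 by linarith]; linarith
  · have := mul_nonneg hs hz.le
    have := mul_pos hr (sub_pos.2 hb)
    linarith

/-- On one side of the level the imaginary part of `coneFun` does not vanish, so the whole
star-shaped side projects radially into the complement. The projection fixes points of the sphere,
so the loop factors through a contractible space. -/
theorem homologyClass_eq_one (h : Admissible R a₁ a₂ b) {γ : Knot R} (hγ : γ.image = FS h)
    {q : γ.Compl} (α : Path q q) {σ : ℝ} (hσ : σ = 1 ∨ σ = -1)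
    (hα : ∀ t, 0 < σ * height b (α t).1) : γ.homologyClass α = 1 := by
  have hX := starConvex_height h.lt_one hσ
  have hne : ∀ z : {z : TPlane | 0 < σ * height b z}, coneFun a₁ a₂ b z.1 ≠ 0 := fun z e => by
    have h1 := z.2
    rw [mem_ofPred_eq, (coneFun_eq_zero.1 e).2, mul_zero] at h1
    exact lt_irrefl _ h1
  have : ContractibleSpace {z : TPlane | 0 < σ * height b z} := hX.contractibleSpace
    ⟨_, hα 0⟩
  have hcα : Continuous fun t => ((α t).1 : TPlane) :=
    (continuous_subtype_val.comp continuous_subtype_val).comp α.continuous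
  have h1 : α.Homotopic (Path.refl q) := homotopic_refl_of_lift
    ((complRadial h hγ).comp ⟨fun z : {z : TPlane | 0 < σ * height b z} => ⟨z.1, hne z⟩,
      continuous_subtype_val.subtype_mk _⟩)
    (x := ⟨q.1, by simpa using hα 0⟩)
    ⟨⟨fun t => ⟨(α t).1, hα t⟩, hcα.subtype_mk _⟩, by simp, by simp⟩ α
    (fun t => complRadial_of_mem h hγ (α t))
  rw [Knot.homologyClass, Path.Homotopic.Quotient.eq.2 h1]
  exact map_one _

/-! ### Connecting base points -/

/-- A segment that avoids the cone over `FS` projects to a path in the complement. -/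
theorem joined_complRadial (h : Admissible R a₁ a₂ b) {γ : Knot R} (hγ : γ.image = FS h)
    {z w : TPlane} (hz : coneFun a₁ a₂ b z ≠ 0) (hw : coneFun a₁ a₂ b w ≠ 0)
    (hseg : ∀ r s : ℝ, 0 < r → 0 < s → r + s = 1 → coneFun a₁ a₂ b (r • z + s • w) ≠ 0) :
    Joined (complRadial h hγ ⟨z, hz⟩) (complRadial h hγ ⟨w, hw⟩) := by
  have hne : ∀ t : unitInterval, coneFun a₁ a₂ b ((1 - t : ℝ) • z + (t : ℝ) • w) ≠ 0 := by
    intro t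
    rcases t.2.1.eq_or_lt with ht | ht
    · rw [← ht]; simpa using hz
    · rcases t.2.2.eq_or_lt with ht' | ht'
      · rw [ht']; simpa using hw
      · exact hseg _ _ (by linarith) ht (by ring)
  refine ⟨⟨⟨fun t => complRadial h hγ ⟨_, hne t⟩, ?_⟩, ?_, ?_⟩⟩
  · exact (complRadial h hγ).continuous.comp (Continuous.subtype_mk (by fun_prop) _)
  · simp
  · simp

theorem coneFun_ne_of_height {z : TPlane} (hz : height b z ≠ 0) : coneFun a₁ a₂ b z ≠ 0 :=
  fun e => hz (coneFun_eq_zero.1 e).2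

theorem height_pole (b σ : ℝ) : height b ((0, σ), 0) = (1 - b) * σ := by
  simp [height]

theorem coneFun_pole (hb : b < 1) {σ : ℝ} (hσ : σ = 1 ∨ σ = -1) :
    coneFun a₁ a₂ b ((0, σ), 0) ≠ 0 := by
  apply coneFun_ne_of_height
  rw [height_pole]
  rcases hσ with rfl | rfl <;> simp <;> linarith

/-- The detour runs through `((1, 0), 0)`: where `y = 0` and `x₁ > 0`, the real part of `coneFun` is
positive, so the level can be crossed. -/
theorem joined_poles (h : Admissible R a₁ a₂ b) {γ : Knot R} (hγ : γ.image = FS h) {σ : ℝ}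
    (hσ : σ = 1 ∨ σ = -1) :
    Joined (complRadial h hγ ⟨_, coneFun_pole h.lt_one hσ⟩)
      (complRadial h hγ ⟨_, coneFun_pole h.lt_one (Or.inl rfl)⟩) := by
  have hb := h.lt_one
  have key : ∀ σ : ℝ, ∀ r s : ℝ, 0 < s → coneFun a₁ a₂ b
      (r • (((0, σ), 0) : TPlane) + s • ((1, 0), 0)) ≠ 0 := by
    intro σ r s hs e
    have h1 := (coneFun_eq_zero.1 e).1
    simp at h1
    rcases h1 with h1 | h1 <;> linarith
  have he : coneFun a₁ a₂ b ((1, 0), 0) ≠ 0 := by simpa using key 0 0 1 one_pos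
  exact (joined_complRadial h hγ _ he fun r s _ hs _ => key σ r s hs).trans
    (joined_complRadial h hγ _ he fun r s _ hs _ => key 1 r s hs).symm

theorem joined_pole_of_height (h : Admissible R a₁ a₂ b) {γ : Knot R} (hγ : γ.image = FS h) {σ : ℝ}
    (hσ : σ = 1 ∨ σ = -1) (q : γ.Compl) (hq : 0 < σ * height b q.1) :
    Joined q (complRadial h hγ ⟨_, coneFun_pole h.lt_one (Or.inl rfl)⟩) := by
  have h1 : Joined (complRadial h hγ ⟨q.1.1, coneFun_ne_zero h hγ q⟩)
      (complRadial h hγ ⟨_, coneFun_pole h.lt_one hσ⟩) := by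
    refine joined_complRadial h hγ _ _ fun r s hr hs hrs => ?_
    have h2 := starConvex_height h.lt_one hσ hq hs.le hr.le (by linarith)
    apply coneFun_ne_of_height
    rw [add_comm]
    exact fun e => by rw [mem_ofPred_eq, e, mul_zero] at h2; exact lt_irrefl _ h2
  rw [complRadial_of_mem] at h1
  exact h1.trans (joined_poles h hγ hσ)

/-- This connects the base point of the meridian from `exists_meridian` to the upper pole: both ends
have height `1 - b`, and `height` is constant along the segment. -/
theorem joined_pole_above (h : Admissible R a₁ a₂ b) {γ : Knot R} (hγ : γ.image = FS h) {x : ℝ}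
    {y : ℝ × ℝ} (h0 : coneFun a₁ a₂ b ((x, b), y) = 0) (hz : coneFun a₁ a₂ b ((x, b + 1), y) ≠ 0) :
    Joined (complRadial h hγ ⟨_, hz⟩)
      (complRadial h hγ ⟨_, coneFun_pole h.lt_one (Or.inl rfl)⟩) := by
  have hb := h.lt_one
  have h1 := (coneFun_eq_zero.1 h0).2
  refine joined_complRadial h hγ _ _ fun r s hr hs hrs => coneFun_ne_of_height ?_
  simp only [height, Prod.fst_add, Prod.snd_add, Prod.smul_fst, Prod.smul_snd, smul_zero, add_zero,
    smul_eq_mul, norm_smul, Real.norm_of_nonneg hr.le, mul_one] at h1 ⊢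
  have h2 : (1 - b) * (r * (b + 1) + s) - b * (r * ‖y‖) = 1 - b := by
    linear_combination r * h1 + (1 - b) * hrs
  rw [h2]
  linarith

end

section

variable {R a₁ a₂ b : ℝ}

/-! ### The linking number -/

theorem fsKnot_extend (h : Admissible R a₁ a₂ b) {t : ℝ} (ht : t ∈ Icc (0 : ℝ) 1) :
    ((fsKnot h).path.extend t : TPlane) = fsFun a₁ a₂ b (squareFun t) := by
  rw [Path.extend_apply _ ht]; rfl

theorem fsKnot_extend_bottom (h : Admissible R a₁ a₂ b) {t : ℝ} (ht : t ∈ Icc (0 : ℝ) (1 / 4)) :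
    ((fsKnot h).path.extend t : TPlane) =
      (((a₂ - a₁) / 2 * (8 * t - 1) + (a₁ + a₂) / 2, b), ((1 - b) * (8 * t - 1), -(1 - b))) := by
  rw [fsKnot_extend h ⟨ht.1, by linarith [ht.2]⟩, squareFun_bottom ht, fsFun, if_pos rfl]
  simp

theorem fsKnot_velocity (h : Admissible R a₁ a₂ b) :
    HasDerivAt (fun t : ℝ => ((fsKnot h).path.extend t : TPlane))
      ((4 * (a₂ - a₁), 0), (8 * (1 - b), 0)) (1 / 8) := by
  have h1 : HasDerivAt (fun t : ℝ => 8 * t - 1) 8 (1 / 8) := by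
    simpa using ((hasDerivAt_id (1 / 8 : ℝ)).const_mul 8).sub_const 1
  have h2 : HasDerivAt (fun t : ℝ => ((((a₂ - a₁) / 2 * (8 * t - 1) + (a₁ + a₂) / 2, b),
      ((1 - b) * (8 * t - 1), -(1 - b))) : TPlane)) ((4 * (a₂ - a₁), 0), (8 * (1 - b), 0))
      (1 / 8) := by
    refine HasDerivAt.prodMk (HasDerivAt.prodMk ?_ (hasDerivAt_const _ _))
      (HasDerivAt.prodMk ?_ (hasDerivAt_const _ _))
    · exact ((h1.const_mul ((a₂ - a₁) / 2)).add_const _).congr_deriv (by ring)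
    · exact (h1.const_mul (1 - b)).congr_deriv (by ring)
  refine h2.congr_of_eventuallyEq ?_
  filter_upwards [Icc_mem_nhds (show (0 : ℝ) < 1 / 8 by norm_num)
    (show (1 / 8 : ℝ) < 1 / 4 by norm_num)] with t ht
  exact fsKnot_extend_bottom h ht

theorem reverse_image (γ : Knot R) : γ.reverse.image = γ.image :=
  γ.path.symm_range

theorem reverse_extend (γ : Knot R) (t : ℝ) : γ.reverse.path.extend t = γ.path.extend (1 - t) :=
  congrFun (Path.extend_symm γ.path) t

theorem oriented_image (h : Admissible R a₁ a₂ b) {γ : Knot R}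
    (hγ : γ = fsKnot h ∨ γ = (fsKnot h).reverse) : γ.image = FS h := by
  rcases hγ with rfl | rfl
  · exact fsKnot_image h
  · rw [reverse_image, fsKnot_image]

/-- In either orientation, some point of an edge has horizontal velocity. -/
theorem oriented_velocity (h : Admissible R a₁ a₂ b) {γ : Knot R}
    (hγ : γ = fsKnot h ∨ γ = (fsKnot h).reverse) : ∃ t₀ ∈ Ioo (0 : ℝ) 1, ∃ u κ : ℝ, κ ≠ 0 ∧
      (γ.path.extend t₀ : TPlane) = (((a₁ + a₂) / 2, b), (0, -(1 - b))) ∧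
      HasDerivAt (fun t : ℝ => (γ.path.extend t : TPlane)) ((u, 0), (κ, 0)) t₀ := by
  have hb : 8 * (1 - b) ≠ 0 := by linarith [h.lt_one]
  have h1 : ((fsKnot h).path.extend (1 / 8) : TPlane) =
      (((a₁ + a₂) / 2, b), (0, -(1 - b))) := by
    rw [fsKnot_extend_bottom h (by norm_num)]; norm_num
  rcases hγ with rfl | rfl
  -- The parameter `1 / 8` is the midpoint of the edge `v₂ = -1`; reversal moves it to `7 / 8`.
  · exact ⟨1 / 8, by norm_num, _, _, hb, h1, fsKnot_velocity h⟩
  · refine ⟨7 / 8, by norm_num, -(4 * (a₂ - a₁)), -(8 * (1 - b)), neg_ne_zero.2 hb, ?_, ?_⟩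
    · rw [reverse_extend, ← h1]; norm_num
    · simp only [reverse_extend]
      have h2 : HasDerivAt (fun t : ℝ => 1 - t) (-1) (7 / 8) := by
        simpa using (hasDerivAt_id (7 / 8 : ℝ)).const_sub 1
      have h3 := HasDerivAt.scomp (7 / 8 : ℝ) (h := fun t : ℝ => 1 - t)
        (g₁ := fun t : ℝ => ((fsKnot h).path.extend t : TPlane))
        (g₁' := ((4 * (a₂ - a₁), 0), (8 * (1 - b), 0))) (by
          rw [show (1 : ℝ) - 7 / 8 = 1 / 8 by norm_num]; exact fsKnot_velocity h) h2
      exact h3.congr_deriv (by simp)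

variable {a₁' a₂' b' : ℝ}

theorem height_FS (h' : Admissible R a₁' a₂' b') {z : PLSphere R} (hz : z ∈ FS h') (b : ℝ) :
    height b z = b' - b := by
  obtain ⟨h1, h2⟩ := FS_spec h' hz
  rw [height, h1, h2]
  ring

theorem exists_sign (hb : b ≠ b') : ∃ σ : ℝ, (σ = 1 ∨ σ = -1) ∧ 0 < σ * (b' - b) := by
  rcases lt_or_gt_of_ne hb with h1 | h1
  · exact ⟨1, Or.inl rfl, by linarith⟩
  · exact ⟨-1, Or.inr rfl, by linarith⟩

theorem isLinkingNumber_iff (h : Admissible R a₁ a₂ b) (h' : Admissible R a₁' a₂' b')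
    (hb : b ≠ b') {γ γ' : Knot R} (hγ : γ = fsKnot h ∨ γ = (fsKnot h).reverse)
    (hγ' : γ' = fsKnot h' ∨ γ' = (fsKnot h').reverse) (n : ℤ) :
    γ.IsLinkingNumber γ' n ↔ n = 0 := by
  have hi := oriented_image h hγ
  have hi' := oriented_image h' hγ'
  obtain ⟨σ, hσ, hσb⟩ := exists_sign hb
  have hpath : ∀ t, 0 < σ * height b (γ'.path t) := fun t => by
    rw [height_FS h' (hi' ▸ mem_range_self t)]
    exact hσb
  constructor
  · rintro ⟨q, α, m, μ, β, hα, hμ, hn⟩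
    rw [homologyClass_eq_one h hi α hσ (fun t => by rw [hα]; exact hpath t)] at hn
    exact eq_zero_of_zpow_eq_one (complMap h hi) μ β (logChange_meridian_ne_zero h hi hμ) hn.symm
  -- Even for `n = 0` the definition demands an actual meridian and a path to it from the base point
  -- of `γ'`.
  · rintro rfl
    have hmem : ∀ t, γ'.path t ∉ γ.image := fun t ht => by
      have h1 := (coneFun_eq_zero.1 (coneFun_eq_zero_of_mem h hi ht)).2
      have h2 := hpath t
      rw [h1, mul_zero] at h2
      exact lt_irrefl _ h2
    have hbase : γ'.base ∉ γ.image := by simpa using hmem 0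
    let q : γ.Compl := ⟨γ'.base, hbase⟩
    let α : Path q q := ⟨⟨fun t => ⟨γ'.path t, hmem t⟩, γ'.path.continuous.subtype_mk _⟩,
      by simp [q], by simp [q]⟩
    obtain ⟨t₀, ht₀, u, κ, hκ, hp, hτ⟩ := oriented_velocity h hγ
    obtain ⟨hz, μ, hμ⟩ := exists_meridian h hi ht₀ (by linarith [h.lt_one]) hp hτ hκ
    have hp0 : coneFun a₁ a₂ b (((a₁ + a₂) / 2, b), (0, -(1 - b))) = 0 := by
      rw [← hp]; exact coneFun_eq_zero_of_mem h hi (extend_mem γ t₀)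
    have hq : 0 < σ * height b q.1 := by simpa using hpath 0
    have hj : Joined q (complRadial h hi ⟨_, hz⟩) :=
      (joined_pole_of_height h hi hσ q hq).trans (joined_pole_above h hi hp0 hz).symm
    refine ⟨q, α, _, μ, hj.somePath, fun t => rfl, hμ, ?_⟩
    rw [zpow_zero]
    exact homologyClass_eq_one h hi α hσ hpath

/-! ### The separating sphere -/

/-- A homeomorphism from the tangent pairs to the Euclidean space that takes the zero set of
`height c` to the equatorial hyperplane. -/
def shear {c : ℝ} (hc : c < 1) : TPlane ≃ₜ EuclideanSpace ℝ (Fin 4) where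
  toFun z := !₂[height c z, z.1.1, z.2.1, z.2.2]
  invFun u := ((u 1, (u 0 + c * ‖((u 2, u 3) : ℝ × ℝ)‖) / (1 - c)), (u 2, u 3))
  left_inv z := by
    have hc' : 1 - c ≠ 0 := by linarith
    refine Prod.ext (Prod.ext rfl ?_) rfl
    change (height c z + c * ‖z.2‖) / (1 - c) = _
    rw [height]
    field_simp
    ring
  right_inv u := by
    have hc' : 1 - c ≠ 0 := by linarith
    ext i
    fin_cases i
    · simp [height]
      field_simp
      ring
    all_goals simp
  continuous_toFun := by
    have := continuous_height c
    refine (PiLp.continuous_toLp 2 _).comp (continuous_pi fun i => ?_)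
    fin_cases i <;> simp <;> fun_prop
  continuous_invFun := by fun_prop

/-- Positive homogeneity makes `shear` carry rays to rays, and hence induce a map between the two
unit spheres. -/
theorem shear_smul {c : ℝ} (hc : c < 1) {r : ℝ} (hr : 0 ≤ r) (z : TPlane) :
    shear hc (r • z) = r • shear hc z := by
  ext i
  fin_cases i
  · exact height_smul c hr z
  all_goals rfl

theorem shear_zero {c : ℝ} (hc : c < 1) : shear hc 0 = 0 := by
  simpa using shear_smul hc le_rfl 0

theorem shear_ne_zero {c : ℝ} (hc : c < 1) {z : TPlane} (hz : z ≠ 0) : shear hc z ≠ 0 :=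
  fun e => hz ((shear hc).injective (e.trans (shear_zero hc).symm))

theorem shear_symm_ne_zero {c : ℝ} (hc : c < 1) {u : EuclideanSpace ℝ (Fin 4)} (hu : u ≠ 0) :
    (shear hc).symm u ≠ 0 := fun e => hu (by
  rw [← (shear hc).apply_symm_apply u, e, shear_zero])

theorem shear_symm_smul {c : ℝ} (hc : c < 1) {r : ℝ} (hr : 0 ≤ r)
    (u : EuclideanSpace ℝ (Fin 4)) : (shear hc).symm (r • u) = r • (shear hc).symm u := by
  apply (shear hc).injective
  rw [shear_smul hc hr, Homeomorph.apply_symm_apply, Homeomorph.apply_symm_apply]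

/-- The homeomorphism of `S(R, 1)` with the round sphere induced by `shear`. -/
def sphereHomeo {c : ℝ} (hR : 0 < R) (hc : c < 1) :
    PLSphere R ≃ₜ Metric.sphere (0 : EuclideanSpace ℝ (Fin 4)) 1 where
  toFun z := ⟨‖shear hc z‖⁻¹ • shear hc z, by
    rw [mem_sphere_zero_iff_norm]
    exact norm_smul_inv_norm (𝕜 := ℝ) (shear_ne_zero hc (ne_zero_of_mem hR z.2))⟩
  invFun u := radial hR ((shear hc).symm u)
    (shear_symm_ne_zero hc (ne_zero_of_mem_unit_sphere u))
  left_inv z := by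
    have h0 := inv_pos.2 (norm_pos_iff.2 (shear_ne_zero hc (ne_zero_of_mem hR z.2)))
    apply Subtype.ext
    simp only [radial]
    rw [shear_symm_smul hc h0.le, Homeomorph.symm_apply_apply, gnorm_smul R h0.le,
      (mem_PLSphere hR).1 z.2, mul_one, inv_smul_smul₀ h0.ne']
  right_inv u := by
    have h0 := inv_pos.2 (gnorm_pos hR (shear_symm_ne_zero hc (ne_zero_of_mem_unit_sphere u)))
    apply Subtype.ext
    simp only [radial]
    rw [shear_smul hc h0.le, Homeomorph.apply_symm_apply, norm_smul, Real.norm_of_nonneg h0.le,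
      mem_sphere_zero_iff_norm.1 u.2, mul_one, inv_smul_smul₀ h0.ne']
  continuous_toFun := by
    have h1 : Continuous fun z : PLSphere R => shear hc z.1 :=
      (shear hc).continuous.comp continuous_subtype_val
    exact ((h1.norm.inv₀ fun z => (norm_pos_iff.2
      (shear_ne_zero hc (ne_zero_of_mem hR z.2))).ne').smul h1).subtype_mk _
  continuous_invFun := continuous_radial hR
    ((shear hc).symm.continuous.comp continuous_subtype_val) _

theorem isEmbeddedSphere_level {c : ℝ} (hR : 0 < R) (hc : c < 1) :
    IsEmbeddedSphere {z : PLSphere R | height c z = 0} := by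
  refine ⟨sphereHomeo hR hc, ?_⟩
  have key : ∀ z : PLSphere R, (sphereHomeo hR hc z).1 0 = 0 ↔ height c z = 0 := fun z => by
    change ‖shear hc z‖⁻¹ * height c z = 0 ↔ _
    rw [mul_eq_zero, or_iff_right
      (inv_ne_zero (norm_ne_zero_iff.2 (shear_ne_zero hc (ne_zero_of_mem hR z.2))))]
  ext u
  constructor
  · rintro ⟨z, hz, rfl⟩
    exact (key z).2 hz
  · intro hu
    refine ⟨(sphereHomeo hR hc).symm u, (key _).1 ?_, Homeomorph.apply_symm_apply _ _⟩
    rw [Homeomorph.apply_symm_apply]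
    exact hu

theorem isConnected_side {c : ℝ} (hR : 0 < R) (hc : c < 1) {σ : ℝ} (hσ : σ = 1 ∨ σ = -1) :
    IsConnected {z : PLSphere R | 0 < σ * height c z} := by
  have hX := starConvex_height hc hσ
  have hpole : ((0, σ), 0) ∈ {z : TPlane | 0 < σ * height c z} := by
    rw [mem_ofPred_eq, height_pole]
    rcases hσ with rfl | rfl <;> linarith
  have hne : ∀ z : {z : TPlane | 0 < σ * height c z}, z.1 ≠ 0 := by
    rintro ⟨z, hz⟩ e
    simp only at e
    rw [mem_ofPred_eq, e] at hz
    simp [height] at hz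
  have : ContractibleSpace {z : TPlane | 0 < σ * height c z} := hX.contractibleSpace ⟨_, hpole⟩
  have h1 := isConnected_range (continuous_radial hR
    (X := {z : TPlane | 0 < σ * height c z}) continuous_subtype_val hne)
  convert h1
  ext z
  constructor
  · intro hz
    exact ⟨⟨z, hz⟩, radial_of_mem hR z.2⟩
  · rintro ⟨w, rfl⟩
    have h2 := inv_pos.2 (gnorm_pos hR (hne w))
    change 0 < σ * height c (_ • w.1)
    rw [height_smul c h2.le, mul_left_comm]
    exact mul_pos h2 w.2

theorem unlinked_FS (h : Admissible R a₁ a₂ b) (h' : Admissible R a₁' a₂' b') (hb : b ≠ b') :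
    Unlinked (FS h) (FS h') := by
  obtain ⟨σ, hσ, hσb⟩ := exists_sign hb.symm
  -- At the midpoint level `height c` equals `(b - b') / 2` on the first circle and its negative on
  -- the second; `σ` is the sign that makes the first positive.
  set c := (b + b') / 2 with hcdef
  have hc : c < 1 := by linarith [h.lt_one, h'.lt_one]
  have hσ' : -σ = 1 ∨ -σ = -1 := by rcases hσ with rfl | rfl <;> simp
  have hcont : Continuous fun z : PLSphere R => height c z :=
    (continuous_height c).comp continuous_subtype_val
  refine ⟨_, isEmbeddedSphere_level h.pos hc, {z | 0 < σ * height c z}, {z | 0 < -σ * height c z},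
    isOpen_lt continuous_const (continuous_const.mul hcont),
    isOpen_lt continuous_const (continuous_const.mul hcont),
    isConnected_side h.pos hc hσ, isConnected_side h.pos hc hσ', ?_, ?_, ?_, ?_⟩
  · rw [disjoint_left]
    intro z hz hz'
    rw [mem_ofPred_eq] at hz hz'
    linarith
  · ext z
    simp only [mem_union, mem_ofPred_eq, mem_compl_iff]
    rcases hσ with rfl | rfl
    · constructor
      · rintro (h1 | h1) <;> intro e <;> linarith
      · intro h1
        rcases lt_or_gt_of_ne h1 with h2 | h2
        · right; linarith
        · left; linarith
    · constructor
      · rintro (h1 | h1) <;> intro e <;> linarith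
      · intro h1
        rcases lt_or_gt_of_ne h1 with h2 | h2
        · left; linarith
        · right; linarith
  · intro z hz
    rw [mem_ofPred_eq, height_FS h hz, hcdef]
    linarith
  · intro z hz
    rw [mem_ofPred_eq, height_FS h' hz, hcdef]
    linarith

theorem disjoint_FS (h : Admissible R a₁ a₂ b) (h' : Admissible R a₁' a₂' b') (hb : b ≠ b') :
    Disjoint (FS h) (FS h') := by
  rw [disjoint_left]
  intro z hz hz'
  have h1 := height_FS h hz b
  rw [height_FS h' hz'] at h1
  exact hb (by linarith)

end

end FSLink

end

theorem proposition2 (R a₁ a₂ b a₁' a₂' b' : ℝ)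
    (h : FSLink.Admissible R a₁ a₂ b) (h' : FSLink.Admissible R a₁' a₂' b') (hb : b ≠ b') :
    Disjoint (FSLink.FS h) (FSLink.FS h') ∧
    FSLink.Unlinked (FSLink.FS h) (FSLink.FS h') ∧
    ∀ γ γ' : FSLink.Knot R,
      (γ = FSLink.fsKnot h ∨ γ = (FSLink.fsKnot h).reverse) →
      (γ' = FSLink.fsKnot h' ∨ γ' = (FSLink.fsKnot h').reverse) →
      ∀ n : ℤ, γ.IsLinkingNumber γ' n ↔ n = 0 := by
  exact ⟨FSLink.disjoint_FS h h' hb, FSLink.unlinked_FS h h' hb,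
    fun _ _ hγ hγ' n => FSLink.isLinkingNumber_iff h h' hb hγ hγ' n⟩
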